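/- Let $V$ be a finite nonempty set. Every $v\in V$ is assigned a pair $M(v)=(u,w)\in V\times V$ (the entries $u,v,w$ need not be different) and a starting value $c_v$, and it is regarded as the function on the positive integers with $v(1)=c_v$ and $$v(n)=\max_{1\le m\le n-1}\bigl(u(n-m)+w(m)\bigr)\qquad(n\ge 2).$$ Let $g(n)=\max_{v\in V}v(n)$; the growth rate of the system is $\lambda=\lim_{n\to\infty}g(n)/n$. When all starting values are rational, the limit $\lambda$ exists and is rational, and it can be computed exactly in time cubic in $|V|$. Precisely, on a random access machine with unit cost integer arithmetic there is a single program that, for every such system (given by $|V|$, by the table of $M$ and by the numerators and denominators of the $c_v$), halts with the numerator and the denominator of $\lambda$ in lowest terms, with the following running time. (i) There is an absolute constant $C$ such that the program takes at most $C\,|V|^2\,(|V|+\ell)$ steps, with all numbers in the run of at most $C(|V|+\ell)$ bits. Here $\ell$ is the number of bits of the least common denominator $d$ of the starting values plus the number of bits of $\max_v|d\,c_v|$. (ii) In particular the time is $O(|V|^3)$ for starting values of bounded size: for every $H$ there is a constant $C_H$ such that, if all numerators and denominators of the starting values are at most $H$ in absolute value, the program takes at most $C_H|V|^3$ steps, with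 all numbers in the run of at most $C_H|V|$ bits. -/

import Mathlib

/-! ## Replacement systems and their growth rate -/

/-- A system of replacements on an index set `V`: every `v` is assigned a pair `(u, w)` of members
of `V` (not necessarily different) and a starting value. -/
structure ReplacementSystem (V : Type*) where
  /-- the assignment `M(v) = (u, w)` -/
  pair : V → V × V
  /-- the starting value `c_v = v(1)` -/
  start : V → ℝ

namespace ReplacementSystem

variable {V : Type*}

/-- `S.value n v` is `v(n)`: `v(1) = c_v`, and `v(n) = max_{1 ≤ m ≤ n-1} u(n-m) + w(m)` for
`n ≥ 2`, where `(u, w) = M(v)`. Below `n` is `k + 2` and `m` is `j + 1` with `0 ≤ j ≤ k`.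
The functions live on the positive integers; the value at `0` is a placeholder. -/
noncomputable def value (S : ReplacementSystem V) : ℕ → V → ℝ
  | 0, _ => 0
  | 1, v => S.start v
  | k + 2, v =>
      Finset.univ.sup' Finset.univ_nonempty fun j : Fin (k + 1) =>
        value S (k + 1 - j.val) (S.pair v).1 + value S (j.val + 1) (S.pair v).2
  termination_by n => n
  decreasing_by
    all_goals have := j.isLt
    all_goals omega

theorem value_one (S : ReplacementSystem V) (v : V) : S.value 1 v = S.start v := by
  rw [value]

/-- The defining recursion in its usual form. -/
theorem value_isGreatest (S : ReplacementSystem V) (v : V) (n : ℕ) (hn : 2 ≤ n) :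
    IsGreatest
      {x : ℝ | ∃ m : ℕ, 1 ≤ m ∧ m ≤ n - 1 ∧
        x = S.value (n - m) (S.pair v).1 + S.value m (S.pair v).2}
      (S.value n v) := by
  obtain ⟨k, rfl⟩ : ∃ k, n = k + 2 := ⟨n - 2, by omega⟩
  rw [value]
  constructor
  · obtain ⟨j, -, hj⟩ := Finset.exists_mem_eq_sup' (Finset.univ_nonempty (α := Fin (k + 1)))
      fun j : Fin (k + 1) =>
        value S (k + 1 - j.val) (S.pair v).1 + value S (j.val + 1) (S.pair v).2
    refine ⟨j.val + 1, by omega, by omega, ?_⟩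
    rw [hj, show k + 2 - (j.val + 1) = k + 1 - j.val by omega]
  · rintro x ⟨m, h1, h2, rfl⟩
    have h := Finset.le_sup' (fun j : Fin (k + 1) =>
        value S (k + 1 - j.val) (S.pair v).1 + value S (j.val + 1) (S.pair v).2)
      (Finset.mem_univ (⟨m - 1, by omega⟩ : Fin (k + 1)))
    simp only at h
    rwa [show k + 1 - (m - 1) = k + 2 - m by omega, show m - 1 + 1 = m by omega] at h

/-- `g(n) = max_v v(n)`. -/
noncomputable def best [Fintype V] [Nonempty V] (S : ReplacementSystem V) (n : ℕ) : ℝ :=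
  Finset.univ.sup' Finset.univ_nonempty fun v => S.value n v

/-- `l` is the growth rate of the system: `g(n)/n` converges to `l`. -/
def IsGrowthRate [Fintype V] [Nonempty V] (S : ReplacementSystem V) (l : ℝ) : Prop :=
  Filter.Tendsto (fun n : ℕ => S.best n / (n : ℝ)) Filter.atTop (nhds l)

end ReplacementSystem

/-! ## A random access machine with unit cost integer arithmetic and bounded word length

Programs use finitely many integer variables and finitely many integer arrays. Reading an array at
a computed index, and each arithmetic operation, test and assignment, is one step. All numbers
that occur in a run must have magnitude less than `2 ^ w`, where `w` is the word length. -/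

namespace RAM

/-- The contents of the variables and of the arrays (each array is indexed by the integers). -/
structure State where
  var : ℕ → ℤ
  arr : ℕ → ℤ → ℤ

/-- Arithmetic expressions. -/
inductive Term where
  | const (k : ℤ)
  | var (x : ℕ)
  | read (a : ℕ) (i : Term)
  | add (e f : Term)
  | sub (e f : Term)
  | mul (e f : Term)
  | div (e f : Term)

namespace Term

/-- The value of an expression; `div` is integer division with remainder
(division by `0` gives `0`). -/
def eval (s : State) : Term → ℤ
  | const k => k
  | var x => s.var x
  | read a i => s.arr a (i.eval s)
  | add e f => e.eval s + f.eval s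
  | sub e f => e.eval s - f.eval s
  | mul e f => e.eval s * f.eval s
  | div e f => e.eval s / f.eval s

/-- The number of steps needed to evaluate an expression: one for each of its nodes. -/
def cost : Term → ℕ
  | const _ => 1
  | var _ => 1
  | read _ i => i.cost + 1
  | add e f => e.cost + f.cost + 1
  | sub e f => e.cost + f.cost + 1
  | mul e f => e.cost + f.cost + 1
  | div e f => e.cost + f.cost + 1

/-- All values that arise in the evaluation of the expression fit into words of length `w`. -/
def Fits (w : ℕ) (s : State) : Term → Prop
  | const k => |k| < 2 ^ w
  | var x => |s.var x| < 2 ^ w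
  | read a i => i.Fits w s ∧ |s.arr a (i.eval s)| < 2 ^ w
  | add e f => e.Fits w s ∧ f.Fits w s ∧ |e.eval s + f.eval s| < 2 ^ w
  | sub e f => e.Fits w s ∧ f.Fits w s ∧ |e.eval s - f.eval s| < 2 ^ w
  | mul e f => e.Fits w s ∧ f.Fits w s ∧ |e.eval s * f.eval s| < 2 ^ w
  | div e f => e.Fits w s ∧ f.Fits w s ∧ |e.eval s / f.eval s| < 2 ^ w

end Term

/-- Programs. -/
inductive Program where
  | skip
  /-- `x := e` -/
  | assign (x : ℕ) (e : Term)
  /-- `a[i] := e` -/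
  | write (a : ℕ) (i e : Term)
  | seq (p q : Program)
  /-- if `e > 0` then `p` else `q` -/
  | branch (e : Term) (p q : Program)
  /-- while `e > 0` do `p` -/
  | loop (e : Term) (p : Program)

/-- The state after `x := k`. -/
def State.setVar (s : State) (x : ℕ) (k : ℤ) : State :=
  { s with var := Function.update s.var x k }

/-- The state after `a[i] := k`. -/
def State.setArr (s : State) (a : ℕ) (i k : ℤ) : State :=
  { s with arr := Function.update s.arr a (Function.update (s.arr a) i k) }

/-- `Exec w p s s' t`: with word length `w`, the program `p` started in the state `s` halts in the
state `s'` after exactly `t` steps (and no number in the run exceeds the word length). -/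
inductive Exec (w : ℕ) : Program → State → State → ℕ → Prop where
  | skip (s : State) : Exec w Program.skip s s 1
  | assign (s : State) (x : ℕ) (e : Term) (he : e.Fits w s) :
      Exec w (Program.assign x e) s (s.setVar x (e.eval s)) (e.cost + 1)
  | write (s : State) (a : ℕ) (i e : Term) (hi : i.Fits w s) (he : e.Fits w s) :
      Exec w (Program.write a i e) s (s.setArr a (i.eval s) (e.eval s)) (i.cost + e.cost + 1)
  | seq {p q : Program} {s s' s'' : State} {t t' : ℕ}
      (hp : Exec w p s s' t) (hq : Exec w q s' s'' t') :
      Exec w (Program.seq p q) s s'' (t + t')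
  | branch_pos {e : Term} {p q : Program} {s s' : State} {t : ℕ} (he : e.Fits w s)
      (hpos : 0 < e.eval s) (hp : Exec w p s s' t) :
      Exec w (Program.branch e p q) s s' (e.cost + 1 + t)
  | branch_neg {e : Term} {p q : Program} {s s' : State} {t : ℕ} (he : e.Fits w s)
      (hneg : e.eval s ≤ 0) (hq : Exec w q s s' t) :
      Exec w (Program.branch e p q) s s' (e.cost + 1 + t)
  | loop_done {e : Term} {p : Program} {s : State} (he : e.Fits w s) (hneg : e.eval s ≤ 0) :
      Exec w (Program.loop e p) s s (e.cost + 1)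
  | loop_step {e : Term} {p : Program} {s s' s'' : State} {t t' : ℕ} (he : e.Fits w s)
      (hpos : 0 < e.eval s) (hp : Exec w p s s' t) (hl : Exec w (Program.loop e p) s' s'' t') :
      Exec w (Program.loop e p) s s'' (e.cost + 1 + t + t')

end RAM

/-! ## Computing the growth rate of a system with rational starting values -/

/-- The system on `Fin n` with assignment `M` and rational starting values `c`. -/
noncomputable def ratSystem {n : ℕ} (M : Fin n → Fin n × Fin n) (c : Fin n → ℚ) :
    ReplacementSystem (Fin n) where
  pair := M
  start := fun v => (c v : ℝ)

/-- The initial state of the machine: variable `0` holds the number `n` of functions, and for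
`v = 0, …, n-1` the entries with index `v` of the arrays `0, 1, 2, 3` are `u`, `w` (where
`M(v) = (u, w)`) and the numerator and the denominator of `c v`; everything else is `0`. -/
def inputState {n : ℕ} (M : Fin n → Fin n × Fin n) (c : Fin n → ℚ) : RAM.State where
  var := fun x => if x = 0 then (n : ℤ) else 0
  arr := fun a i =>
    if h : 0 ≤ i ∧ i < (n : ℤ) then
      let v : Fin n := ⟨i.toNat, by omega⟩
      if a = 0 then (((M v).1 : ℕ) : ℤ)
      else if a = 1 then (((M v).2 : ℕ) : ℤ)
      else if a = 2 then (c v).num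
      else if a = 3 then ((c v).den : ℤ)
      else 0
    else 0

/-- The least common denominator of the starting values. -/
def commonDen {n : ℕ} (c : Fin n → ℚ) : ℕ :=
  Finset.univ.lcm fun v => (c v).den

/-- The largest magnitude of the integers to which the starting values scale under
multiplication by their least common denominator. -/
def scaledMax {n : ℕ} (c : Fin n → ℚ) : ℕ :=
  Finset.univ.sup fun v => ((commonDen c : ℚ) * c v).num.natAbs

/-- The number of bits of the least common denominator and of the largest scaled starting value. -/
def bitLength {n : ℕ} (c : Fin n → ℚ) : ℕ :=
  Nat.size (commonDen c) + Nat.size (scaledMax c)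

/-- On the input `(M, c)`, with word length `w`, the program halts after at most `t` steps with the
exact growth rate of the system as output: the growth rate exists, it is a rational number `r`, and
the final values of the variables `0` and `1` are the numerator and the denominator of `r` in
lowest terms. -/
def ComputesGrowthRate (P : RAM.Program) {n : ℕ} [NeZero n] (M : Fin n → Fin n × Fin n)
    (c : Fin n → ℚ) (w t : ℕ) : Prop :=
  ∃ r : ℚ, (ratSystem M c).IsGrowthRate (r : ℝ) ∧
    ∃ (s : RAM.State) (k : ℕ), RAM.Exec w P (inputState M c) s k ∧ k ≤ t ∧
      s.var 0 = r.num ∧ s.var 1 = (r.den : ℤ)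

/-! Unfolding the recursion, v(n) is the largest sum of starting values over the leaves of a binary
tree with n leaves that grows from v by replacements. Multiplication by the common denominator d
makes all starting values integers. To compare the growth rate with a/(B d), give each leaf v the
weight B d c_v - a and optimise over trees of bounded depth instead of trees with a given number of
leaves.

If round |V| + 1 of this optimisation improves nothing on round |V|, the optima h satisfy h(u) +
h(w) ≤ h(v), and induction on n gives B d v(n) ≤ a n + h(v) (`IsValue.le_of_stable`). If it improves
something, the improvement is inherited from a child on every level, and the resulting path of |V| +
1 functions visits one of them twice (`IsValue.exists_chain`, `IsValue.exists_gain_of_unstable`).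
This is a cycle that adds T ≤ 2^(|V|+1) leaves and gains W, with W/T > a/B. Only finitely many pairs
(W, T) are possible, so a best ratio exists; the growth rate is W/(T d) for it, and the test decides
exactly whether a/B < W/T (`IsValue.exists_ratio`, `exists_growthRate`).

One test takes O(|V|²) steps. With B = 2^(2|V|+4), bisection confines W/T to an interval of length
1/B after O(|V| + ℓ) tests. As T ≤ 2^(|V|+1), the interval is so short that W/T is the value of a
continued fraction convergent of its midpoint, which Euclid's algorithm finds
(`IsApprox.round_mul_eq`). The bisection dominates the running time. Optima at most double in
magnitude per round apart from the leaf weights' own size, so O(|V| + ℓ) bits suffice. For entries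
bounded by H the number d divides H!, hence ℓ is bounded and the cubic bound follows. -/

namespace ReplacementSystem

/-! ### Trees of bounded depth and gains along replacements -/

variable {V : Type*}

/-- The largest total weight of a tree of depth at most `k` that grows from `v` by replacements,
where the leaf `v` has the weight `b v`. -/
def optimum (pair : V → V × V) (b : V → ℤ) : ℕ → V → ℤ
  | 0, v => b v
  | k + 1, v => max (b v) (optimum pair b k (pair v).1 + optimum pair b k (pair v).2)

theorem optimum_le_succ (pair : V → V × V) (b : V → ℤ) (k : ℕ) (v : V) :
    optimum pair b k v ≤ optimum pair b (k + 1) v := by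
  induction k generalizing v with
  | zero => exact le_max_left _ _
  | succ k ih => exact max_le_max le_rfl (add_le_add (ih _) (ih _))

theorem optimum_mono (pair : V → V × V) (b : V → ℤ) (v : V) :
    Monotone fun k => optimum pair b k v :=
  monotone_nat_of_le_succ fun k => optimum_le_succ pair b k v

theorem le_optimum (pair : V → V × V) (b : V → ℤ) (k : ℕ) (v : V) :
    b v ≤ optimum pair b k v :=
  optimum_mono pair b v (Nat.zero_le k)

/-- A binary tree of depth at most k has at most 2^k leaves. This later keeps the table of optima
within the word length. -/
theorem abs_optimum_le (pair : V → V × V) (b : V → ℤ) {D : ℤ} (hD : ∀ v, |b v| ≤ D) (k : ℕ)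
    (v : V) : |optimum pair b k v| ≤ 2 ^ k * D := by
  induction k generalizing v with
  | zero => simpa [optimum] using hD v
  | succ k ih =>
    have h0 : 0 ≤ D := (abs_nonneg _).trans (hD v)
    have h1 := abs_le.mp (ih (pair v).1)
    have h2 := abs_le.mp (ih (pair v).2)
    have h3 := abs_le.mp (hD v)
    have h4 : D ≤ 2 ^ (k + 1) * D := le_mul_of_one_le_left h0 (one_le_pow₀ (by norm_num))
    have h5 : (2 : ℤ) ^ (k + 1) * D = 2 ^ k * D + 2 ^ k * D := by ring
    refine abs_le.mpr ⟨?_, ?_⟩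
    · exact le_trans (by linarith) (le_max_left (b v) _)
    · exact max_le (by linarith) (by linarith)

/-- `f` satisfies the recursion of the system `pair` with the integral starting values `c`. -/
structure IsValue (pair : V → V × V) (c : V → ℤ) (f : ℕ → V → ℝ) : Prop where
  one : ∀ v, f 1 v = c v
  add_le : ∀ v m k, 1 ≤ m → 1 ≤ k → f m (pair v).1 + f k (pair v).2 ≤ f (m + k) v
  exists_eq : ∀ v n, 2 ≤ n →
    ∃ m k, 1 ≤ m ∧ 1 ≤ k ∧ m + k = n ∧ f n v = f m (pair v).1 + f k (pair v).2

/-- Growing `v` from `u` by replacements with `T` further leaves gains at least `W`. -/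
def Gain (f : ℕ → V → ℝ) (W : ℤ) (T : ℕ) (u v : V) : Prop :=
  ∀ m, 1 ≤ m → f m v + W ≤ f (m + T) u

theorem Gain.trans {f : ℕ → V → ℝ} {W W' : ℤ} {T T' : ℕ} {u v w : V} (h : Gain f W T u v)
    (h' : Gain f W' T' v w) : Gain f (W + W') (T + T') u w := by
  intro m hm
  have h1 := h' m hm
  have h2 := h (m + T') (by omega)
  rw [show m + (T + T') = m + T' + T by omega]
  push_cast
  linarith

theorem Gain.iterate {f : ℕ → V → ℝ} {W : ℤ} {T : ℕ} {v : V} (h : Gain f W T v v) (k m : ℕ)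
    (hm : 1 ≤ m) : f m v + k * W ≤ f (m + k * T) v := by
  induction k with
  | zero => simp
  | succ k ih =>
    have h1 := h (m + k * T) (by omega)
    rw [show m + (k + 1) * T = m + k * T + T by ring]
    push_cast
    linarith

/-- The weights of the leaves when every starting value `c v` is replaced by `B * c v - a`. -/
def shift (c : V → ℤ) (a B : ℤ) (v : V) : ℤ := B * c v - a

/-! ### Stability of shifted systems and cycles of large gain -/

section

variable {pair : V → V × V} {c : V → ℤ} {f : ℕ → V → ℝ}

/-- Stable optima act as a potential h with h(u) + h(w) ≤ h(v): the error terms of the two subtrees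
merge into a single one, so the error does not grow with the number of leaves. -/
theorem IsValue.le_of_stable (hf : IsValue pair c f) {a B : ℤ} (hB : 0 < B) {K : ℕ}
    (hst : ∀ v, optimum pair (shift c a B) (K + 1) v ≤ optimum pair (shift c a B) K v)
    (m : ℕ) (hm : 1 ≤ m) (v : V) : B * f m v ≤ a * m + optimum pair (shift c a B) K v := by
  induction m using Nat.strong_induction_on generalizing v with
  | _ m ih =>
    have hB' : (0 : ℝ) < B := by exact_mod_cast hB
    rcases eq_or_lt_of_le hm with rfl | hm2
    · have h := le_optimum pair (shift c a B) K v
      have h' : ((B * c v - a : ℤ) : ℝ) ≤ optimum pair (shift c a B) K v := by exact_mod_cast h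
      push_cast at h'
      rw [hf.one]
      push_cast
      linarith
    · obtain ⟨j, k, hj, hk, hjk, he⟩ := hf.exists_eq v m hm2
      have h1 := ih j (by omega) hj (pair v).1
      have h2 := ih k (by omega) hk (pair v).2
      have h3 := (le_max_right (shift c a B v) _).trans (hst v)
      have h3' : ((optimum pair (shift c a B) K (pair v).1 : ℤ) : ℝ)
          + optimum pair (shift c a B) K (pair v).2 ≤ optimum pair (shift c a B) K v := by
        exact_mod_cast h3
      have h4 : (m : ℝ) = j + k := by exact_mod_cast hjk.symm
      rw [he, h4, mul_add]
      linarith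

/-- Describes an optimal tree by its number of leaves `T` and its unshifted weight `W`. Only `W ≤ f
T v` can be claimed, since a deeper tree with as many leaves may be heavier. -/
theorem IsValue.exists_optimum_eq (hf : IsValue pair c f) {M : ℤ} (hM : ∀ v, |c v| ≤ M)
    (a B : ℤ) (k : ℕ) (v : V) :
    ∃ (W : ℤ) (T : ℕ), 1 ≤ T ∧ T ≤ 2 ^ k ∧ |W| ≤ M * T ∧ (W : ℝ) ≤ f T v ∧
      optimum pair (shift c a B) k v = B * W - a * T := by
  have base : ∀ (k : ℕ) (v : V), ∃ (W : ℤ) (T : ℕ), 1 ≤ T ∧ T ≤ 2 ^ k ∧ |W| ≤ M * T ∧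
      (W : ℝ) ≤ f T v ∧ shift c a B v = B * W - a * T := fun k v =>
    ⟨c v, 1, le_rfl, Nat.one_le_two_pow, by simpa using hM v, (hf.one v).ge, by simp [shift]⟩
  induction k generalizing v with
  | zero => exact base 0 v
  | succ k ih =>
    rcases le_total (optimum pair (shift c a B) k (pair v).1
      + optimum pair (shift c a B) k (pair v).2) (shift c a B v) with h | h
    · rw [optimum, max_eq_left h]
      exact base (k + 1) v
    · rw [optimum, max_eq_right h]
      obtain ⟨W, T, hT, hT2, hW, hWf, he⟩ := ih (pair v).1
      obtain ⟨W', T', hT', hT2', hW', hWf', he'⟩ := ih (pair v).2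
      refine ⟨W + W', T + T', by omega, by rw [pow_succ]; omega, ?_, ?_, ?_⟩
      · refine (abs_add_le _ _).trans ?_
        push_cast
        linarith
      · have := hf.add_le v T T' hT hT'
        push_cast
        linarith
      · rw [he, he']
        push_cast
        ring

/-- An optimum that rises in a late round is attained by a replacement, so it is the sum of the
children's optima of the round before. If neither child had risen there, this sum would have been
available one round earlier. The child that rose is `v'`; the optimal tree of the other child
supplies the gain `W` and the `T` further leaves. -/
theorem IsValue.exists_descent (hf : IsValue pair c f) {M : ℤ} (hM : ∀ v, |c v| ≤ M)
    (a B : ℤ) (k : ℕ) (v : V)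
    (hv : optimum pair (shift c a B) (k + 1) v < optimum pair (shift c a B) (k + 2) v) :
    ∃ (v' : V) (W : ℤ) (T : ℕ),
      optimum pair (shift c a B) k v' < optimum pair (shift c a B) (k + 1) v' ∧
      1 ≤ T ∧ T ≤ 2 ^ (k + 1) ∧ |W| ≤ M * T ∧ Gain f W T v v' ∧
      optimum pair (shift c a B) (k + 2) v
        = optimum pair (shift c a B) (k + 1) v' + (B * W - a * T) := by
  have hb : shift c a B v < optimum pair (shift c a B) (k + 2) v :=
    (le_optimum pair _ (k + 1) v).trans_lt hv
  have he : optimum pair (shift c a B) (k + 2) v = optimum pair (shift c a B) (k + 1) (pair v).1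
      + optimum pair (shift c a B) (k + 1) (pair v).2 := by
    rw [optimum] at hb ⊢
    rcases lt_max_iff.mp hb with h | h
    · exact absurd h (lt_irrefl _)
    · exact max_eq_right h.le
  have hlow : optimum pair (shift c a B) k (pair v).1 + optimum pair (shift c a B) k (pair v).2
      ≤ optimum pair (shift c a B) (k + 1) v := le_max_right _ _
  by_cases h1 : optimum pair (shift c a B) k (pair v).1
      < optimum pair (shift c a B) (k + 1) (pair v).1
  · obtain ⟨W, T, hT, hT2, hW, hWf, hx⟩ := hf.exists_optimum_eq hM a B (k + 1) (pair v).2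
    refine ⟨(pair v).1, W, T, h1, hT, hT2, hW, fun m hm => ?_, by rw [he, hx]⟩
    have := hf.add_le v m T hm hT
    linarith
  · obtain ⟨W, T, hT, hT2, hW, hWf, hx⟩ := hf.exists_optimum_eq hM a B (k + 1) (pair v).1
    refine ⟨(pair v).2, W, T, by omega, hT, hT2, hW, fun m hm => ?_, by rw [he, hx, add_comm]⟩
    have := hf.add_le v T m hT hm
    rw [add_comm m T]
    linarith

/-- Iterated descent, with the gains composed along every segment of the path. The form `T + 2 ^ (j
+ 1) ≤ 2 ^ (i + 1)` makes the leaf bounds of the single steps telescope. -/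
theorem IsValue.exists_chain (hf : IsValue pair c f) {M : ℤ} (hM : ∀ v, |c v| ≤ M)
    (a B : ℤ) (K : ℕ) (v : V)
    (hv : optimum pair (shift c a B) K v < optimum pair (shift c a B) (K + 1) v) :
    ∃ p : ℕ → V, p K = v ∧
      (∀ i ≤ K, optimum pair (shift c a B) i (p i) < optimum pair (shift c a B) (i + 1) (p i)) ∧
      ∀ i ≤ K, ∀ j < i, ∃ (W : ℤ) (T : ℕ), 1 ≤ T ∧ T + 2 ^ (j + 1) ≤ 2 ^ (i + 1) ∧
        |W| ≤ M * T ∧ Gain f W T (p i) (p j) ∧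
        optimum pair (shift c a B) (i + 1) (p i)
          = optimum pair (shift c a B) (j + 1) (p j) + (B * W - a * T) := by
  induction K generalizing v with
  | zero =>
    refine ⟨fun _ => v, rfl, fun i hi => ?_, fun i hi j hj => by omega⟩
    obtain rfl : i = 0 := by omega
    exact hv
  | succ K ih =>
    obtain ⟨v', W, T, hv', hT, hT2, hW, hg, he⟩ := hf.exists_descent hM a B K v hv
    obtain ⟨p, hpK, hp1, hp2⟩ := ih v' hv'
    refine ⟨Function.update p (K + 1) v, by simp, fun i hi => ?_, fun i hi j hj => ?_⟩
    · rcases eq_or_lt_of_le hi with rfl | hi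
      · simpa using hv
      · rw [Function.update_of_ne (by omega)]
        exact hp1 i (by omega)
    · rw [Function.update_of_ne (a := j) (by omega)]
      rcases eq_or_lt_of_le hi with rfl | hi
      · rw [Function.update_self]
        rcases eq_or_lt_of_le (Nat.lt_succ_iff.mp hj) with rfl | hjK
        · rw [hpK]
          exact ⟨W, T, hT, by rw [pow_succ 2 (j + 1)]; omega, hW, hg, he⟩
        · obtain ⟨W', T', hT', hT2', hW', hg', he'⟩ := hp2 K le_rfl j hjK
          rw [hpK] at hg' he'
          refine ⟨W + W', T + T', by omega, by rw [pow_succ 2 (K + 1)]; omega, ?_,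
            hg.trans hg', ?_⟩
          · refine (abs_add_le _ _).trans ?_
            push_cast
            linarith
          · rw [he, he']
            push_cast
            ring
      · rw [Function.update_of_ne (by omega)]
        exact hp2 i (by omega) j hj

variable [Fintype V]

/-- Pigeonhole on |V| + 1 levels. If levels j < i carry the same function, its optimum in round j +
1 is at most that in round i, which is strictly less than that in round i + 1; the difference is the
shifted gain of the cycle, hence positive. -/
theorem IsValue.exists_gain_of_unstable (hf : IsValue pair c f) {M : ℤ} (hM : ∀ v, |c v| ≤ M)
    (a B : ℤ) (v : V)
    (hv : optimum pair (shift c a B) (Fintype.card V) v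
      < optimum pair (shift c a B) (Fintype.card V + 1) v) :
    ∃ (u : V) (W : ℤ) (T : ℕ), 1 ≤ T ∧ T ≤ 2 ^ (Fintype.card V + 1) ∧ |W| ≤ M * T ∧
      Gain f W T u u ∧ a * T < B * W := by
  obtain ⟨p, -, hp1, hp2⟩ := hf.exists_chain hM a B _ v hv
  obtain ⟨x, y, hxy, hpxy⟩ := Fintype.exists_ne_map_eq_of_card_lt
    (fun i : Fin (Fintype.card V + 1) => p i) (by simp)
  have key : ∀ i j : ℕ, i ≤ Fintype.card V → j < i → p i = p j →
      ∃ (u : V) (W : ℤ) (T : ℕ), 1 ≤ T ∧ T ≤ 2 ^ (Fintype.card V + 1) ∧ |W| ≤ M * T ∧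
        Gain f W T u u ∧ a * T < B * W := by
    intro i j hi hj hij
    obtain ⟨W, T, hT, hT2, hW, hg, he⟩ := hp2 i hi j hj
    have hpow : 2 ^ (i + 1) ≤ 2 ^ (Fintype.card V + 1) :=
      Nat.pow_le_pow_right (by norm_num) (by omega)
    rw [← hij] at hg he
    have h1 := hp1 i hi
    have h2 := optimum_mono pair (shift c a B) (p i) (show j + 1 ≤ i by omega)
    simp only at h2
    exact ⟨p i, W, T, hT, (Nat.le_of_add_right_le hT2).trans hpow, hW, hg, by linarith⟩
  have hne : (x : ℕ) ≠ y := fun h => hxy (Fin.ext h)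
  rcases lt_or_gt_of_ne hne with h | h
  · exact key y x (by omega) h hpxy.symm
  · exact key x y (by omega) h hpxy

/-- The largest ratio of the gain to the number of leaves of a cycle decides the stability of all
shifted systems. -/
theorem IsValue.exists_ratio [Nonempty V] (hf : IsValue pair c f) {M : ℤ}
    (hM : ∀ v, |c v| ≤ M) :
    ∃ (u : V) (W : ℤ) (T : ℕ), 1 ≤ T ∧ T ≤ 2 ^ (Fintype.card V + 1) ∧ |W| ≤ M * T ∧
      Gain f W T u u ∧ ∀ a B : ℤ, 0 < B →
        ((∀ v, optimum pair (shift c a B) (Fintype.card V + 1) v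
            ≤ optimum pair (shift c a B) (Fintype.card V) v) ↔ B * W ≤ a * T) := by
  classical
  have hM0 : 0 ≤ M := (abs_nonneg _).trans (hM (Classical.arbitrary V))
  set Q : ℕ := 2 ^ (Fintype.card V + 1) with hQ
  let R : Set (ℤ × ℕ) := {q | 1 ≤ q.2 ∧ q.2 ≤ Q ∧ |q.1| ≤ M * q.2 ∧ ∃ u, Gain f q.1 q.2 u u}
  have hfin : R.Finite := by
    refine ((Set.finite_Icc (-(M * Q)) (M * Q)).prod (Set.finite_Icc 1 Q)).subset ?_
    rintro ⟨W, T⟩ ⟨h1, h2, h3, -⟩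
    have h4 : M * (T : ℤ) ≤ M * Q := mul_le_mul_of_nonneg_left (by exact_mod_cast h2) hM0
    have h5 := abs_le.mp (h3.trans h4)
    exact ⟨h5, h1, h2⟩
  have hunst : ∀ a B : ℤ, (¬ ∀ v, optimum pair (shift c a B) (Fintype.card V + 1) v
            ≤ optimum pair (shift c a B) (Fintype.card V) v) →
      ∃ q ∈ R, a * q.2 < B * q.1 := by
    intro a B h
    push Not at h
    obtain ⟨v, hv⟩ := h
    obtain ⟨u, W, T, h1, h2, h3, h4, h5⟩ := hf.exists_gain_of_unstable hM a B v hv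
    exact ⟨(W, T), ⟨h1, h2, h3, u, h4⟩, h5⟩
  have hne : R.Nonempty := by
    -- This shift makes all leaf weights positive. Stability would then fail at a function with the
    -- least optimum: the sum of its children's positive optima exceeds it.
    obtain ⟨q, hq, -⟩ := hunst (-(M + 1)) 1 (by
      intro h
      set X := optimum pair (shift c (-(M + 1)) 1) (Fintype.card V)
      have hpos : ∀ v, 0 < X v := fun v => by
        have h1 := le_optimum pair (shift c (-(M + 1)) 1) (Fintype.card V) v
        have h2 := (abs_le.mp (hM v)).1
        simp only [shift] at h1
        show 0 < optimum _ _ _ _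
        linarith
      obtain ⟨v, hv⟩ := Finite.exists_min X
      have h1 := (le_max_right _ _).trans (h v)
      have h2 := hpos (pair v).2
      have h3 := hv (pair v).1
      change X (pair v).1 + X (pair v).2 ≤ X v at h1
      linarith)
    exact ⟨q, hq⟩
  obtain ⟨⟨W, T⟩, hWT, hmax⟩ := Set.exists_max_image R (fun q => (q.1 : ℚ) / q.2) hfin hne
  obtain ⟨hT1, hT2, hW, u, hg⟩ := hWT
  refine ⟨u, W, T, hT1, hT2, hW, hg, fun a B hB => ⟨fun h => ?_, fun h => ?_⟩⟩
  · by_contra hlt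
    push Not at hlt
    have hlt' : (0 : ℝ) < B * W - a * T := by
      have : ((a * T : ℤ) : ℝ) < ((B * W : ℤ) : ℝ) := by exact_mod_cast hlt
      push_cast at this
      linarith
    -- Each passage through the cycle gains B W - a T > 0 over the slope a/B, so enough of them
    -- exceed the constant error of `le_of_stable`.
    obtain ⟨k, hk⟩ := Archimedean.arch (a + optimum pair (shift c a B) (Fintype.card V) u
      - B * f 1 u + 1 : ℝ) hlt'
    rw [nsmul_eq_mul] at hk
    have hB' : (0 : ℝ) < B := by exact_mod_cast hB
    have h1 := hg.iterate k 1 le_rfl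
    have h2 := hf.le_of_stable hB h (1 + k * T) (by omega) u
    have h3 := mul_le_mul_of_nonneg_left h1 hB'.le
    push_cast at h2
    nlinarith
  · by_contra hns
    obtain ⟨⟨W', T'⟩, hR, hlt⟩ := hunst a B hns
    have hle := hmax _ hR
    have hT1' : 1 ≤ T' := hR.1
    simp only at hle hlt
    have hTp : (0 : ℚ) < T := by exact_mod_cast hT1
    have hTp' : (0 : ℚ) < T' := by exact_mod_cast hT1'
    rw [div_le_div_iff₀ hTp' hTp] at hle
    have hle' : W' * T ≤ W * T' := by exact_mod_cast hle
    have hTz : (0 : ℤ) < T := by exact_mod_cast hT1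
    have hTz' : (0 : ℤ) < T' := by exact_mod_cast hT1'
    have h1 := mul_lt_mul_of_pos_right hlt hTz
    have h2 := mul_le_mul_of_nonneg_right h hTz'.le
    have h3 := mul_le_mul_of_nonneg_left hle' hB.le
    nlinarith

end

/-! ### From the best cycle to the growth rate -/

theorem isValue_of_scaled (S : ReplacementSystem V) (c : V → ℤ) (d : ℝ) (hd : 0 ≤ d)
    (hc : ∀ v, d * S.start v = c v) : IsValue S.pair c fun m v => d * S.value m v where
  one v := by rw [value_one, hc]
  add_le v m k hm hk := by
    have h := (S.value_isGreatest v (m + k) (by omega)).2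
      ⟨k, hk, by omega, rfl⟩
    rw [Nat.add_sub_cancel] at h
    rw [← mul_add]
    exact mul_le_mul_of_nonneg_left h hd
  exists_eq v n hn := by
    obtain ⟨m, h1, h2, h3⟩ := (S.value_isGreatest v n hn).1
    exact ⟨n - m, m, by omega, h1, by omega, by rw [h3, mul_add]⟩

theorem isGrowthRate_of_bounds [Fintype V] [Nonempty V] (S : ReplacementSystem V) {l C : ℝ}
    (hle : ∀ m, 1 ≤ m → ∀ v, S.value m v ≤ l * m + C) {u : V}
    (hge : ∀ m, 1 ≤ m → l * m - C ≤ S.value m u) : S.IsGrowthRate l := by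
  have h0 : Filter.Tendsto (fun n : ℕ => C / (n : ℝ)) Filter.atTop (nhds 0) :=
    tendsto_const_div_atTop_nhds_zero_nat C
  have h1 : Filter.Tendsto (fun n : ℕ => l - C / (n : ℝ)) Filter.atTop (nhds l) := by
    simpa using h0.const_sub l
  have h2 : Filter.Tendsto (fun n : ℕ => l + C / (n : ℝ)) Filter.atTop (nhds l) := by
    simpa using h0.const_add l
  refine tendsto_of_tendsto_of_tendsto_of_le_of_le' h1 h2 ?_ ?_
  · filter_upwards [Filter.eventually_ge_atTop 1] with m hm
    have hm' : (0 : ℝ) < m := by exact_mod_cast hm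
    rw [le_div_iff₀ hm', sub_mul, div_mul_cancel₀ _ hm'.ne']
    exact (hge m hm).trans (Finset.le_sup' (fun v => S.value m v) (Finset.mem_univ u))
  · filter_upwards [Filter.eventually_ge_atTop 1] with m hm
    have hm' : (0 : ℝ) < m := by exact_mod_cast hm
    rw [div_le_iff₀ hm', add_mul, div_mul_cancel₀ _ hm'.ne']
    exact Finset.sup'_le _ _ fun v _ => hle m hm v

/-- If `d` clears the denominators of the starting values, the growth rate is `W / (T * d)` with a
denominator `T ≤ 2 ^ (|V| + 1)`, and its position relative to `a / (B * d)` is decided by `|V| + 1`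
rounds of the depth-limited recursion. -/
theorem exists_growthRate [Fintype V] [Nonempty V] (S : ReplacementSystem V) (c : V → ℤ) (d : ℝ)
    (hd : 0 < d) (hc : ∀ v, d * S.start v = c v) {M : ℤ} (hM : ∀ v, |c v| ≤ M) :
    ∃ (W : ℤ) (T : ℕ), 1 ≤ T ∧ T ≤ 2 ^ (Fintype.card V + 1) ∧ |W| ≤ M * T ∧
      S.IsGrowthRate (W / (T * d)) ∧ ∀ a B : ℤ, 0 < B →
        ((∀ v, optimum S.pair (shift c a B) (Fintype.card V + 1) v
            ≤ optimum S.pair (shift c a B) (Fintype.card V) v) ↔ B * W ≤ a * T) := by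
  have hf := isValue_of_scaled S c d hd.le hc
  obtain ⟨u, W, T, hT1, hT2, hW, hg, hst⟩ := hf.exists_ratio hM
  refine ⟨W, T, hT1, hT2, hW, ?_, hst⟩
  have hTz : (0 : ℤ) < T := by exact_mod_cast hT1
  have hTr : (0 : ℝ) < T := by exact_mod_cast hT1
  -- The best ratio itself counts as stable, so the upper bound holds with the exact slope.
  have hup := hf.le_of_stable hTz ((hst W T hTz).mpr (by rw [mul_comm]))
  obtain ⟨C₁, hC₁⟩ : ∃ C₁ : ℝ, ∀ v,
      (optimum S.pair (shift c W T) (Fintype.card V) v : ℝ) / (T * d) ≤ C₁ := by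
    obtain ⟨v, hv⟩ := Finite.exists_max fun v =>
      (optimum S.pair (shift c W T) (Fintype.card V) v : ℝ) / (T * d)
    exact ⟨_, hv⟩
  obtain ⟨C₂, hC₂⟩ : ∃ C₂ : ℝ, ∀ r : Fin T,
      W / (T * d) * ((r : ℕ) + 1 : ℝ) - S.value (r + 1) u ≤ C₂ := by
    have : Nonempty (Fin T) := ⟨⟨0, hT1⟩⟩
    obtain ⟨v, hv⟩ := Finite.exists_max fun r : Fin T =>
      W / (T * d) * ((r : ℕ) + 1 : ℝ) - S.value (r + 1) u
    exact ⟨_, hv⟩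
  refine isGrowthRate_of_bounds S (C := max C₁ C₂) (u := u) (fun m hm v => ?_) fun m hm => ?_
  · have h := hup m hm v
    have h1 := (hC₁ v).trans (le_max_left C₁ C₂)
    have h2 : S.value m v ≤ W / (T * d) * m
        + (optimum S.pair (shift c W T) (Fintype.card V) v : ℝ) / (T * d) := by
      rw [div_mul_eq_mul_div, ← add_div, le_div_iff₀ (by positivity)]
      push_cast at h
      linarith
    linarith
  -- Iterating the cycle reaches `m` from one of the starting points 1, …, `T`; the finitely many
  -- deviations there are bounded by `C₂`.
  · obtain ⟨k, r, hr, rfl⟩ : ∃ k r, r < T ∧ m = r + 1 + k * T :=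
      ⟨(m - 1) / T, (m - 1) % T, Nat.mod_lt _ hT1, by
        have := Nat.div_add_mod' (m - 1) T
        omega⟩
    have h := hg.iterate k (r + 1) (by omega)
    have h1 := (hC₂ ⟨r, hr⟩).trans (le_max_right C₁ C₂)
    simp only at h1
    have h2 : S.value (r + 1) u + k * (W / d) ≤ S.value (r + 1 + k * T) u := by
      rw [← mul_le_mul_iff_right₀ hd, mul_add]
      have : d * (k * (W / d)) = k * W := by field_simp
      linarith
    have h3 : (W / (T * d) : ℝ) * ((r + 1 + k * T : ℕ) : ℝ)
        = W / (T * d) * ((r : ℝ) + 1) + k * (W / d) := by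
      push_cast
      field_simp
    rw [h3]
    linarith

end ReplacementSystem

/-! ### Sizes of intermediate values and frame properties of runs -/

namespace RAM

namespace Term

/-- If all numbers in a state are less than `N ≥ 2` in magnitude, then the numbers that occur in the
evaluation of `e` are less than `N ^ e.weight`. -/
def weight : Term → ℕ
  | const k => k.natAbs + 1
  | var _ => 1
  | read _ i => i.weight
  | add e f => max e.weight f.weight + 1
  | sub e f => max e.weight f.weight + 1
  | mul e f => e.weight + f.weight
  | div e f => max e.weight f.weight

end Term

namespace Program

/-- The variables that a program assigns. -/
def vars : Program → List ℕ
  | skip => []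
  | assign x _ => [x]
  | write _ _ _ => []
  | seq p q => p.vars ++ q.vars
  | branch _ p q => p.vars ++ q.vars
  | loop _ p => p.vars

/-- The arrays that a program writes. -/
def arrs : Program → List ℕ
  | skip => []
  | assign _ _ => []
  | write a _ _ => [a]
  | seq p q => p.arrs ++ q.arrs
  | branch _ p q => p.arrs ++ q.arrs
  | loop _ p => p.arrs

end Program

@[simp] theorem State.setVar_var (s : State) (x y : ℕ) (k : ℤ) :
    (s.setVar x k).var y = if y = x then k else s.var y := by
  simp [State.setVar, Function.update_apply]

@[simp] theorem State.setVar_arr (s : State) (x : ℕ) (k : ℤ) : (s.setVar x k).arr = s.arr := rfl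

@[simp] theorem State.setArr_var (s : State) (a : ℕ) (i k : ℤ) :
    (s.setArr a i k).var = s.var := rfl

@[simp] theorem State.setArr_arr (s : State) (a b : ℕ) (i k j : ℤ) :
    (s.setArr a i k).arr b j = if b = a ∧ j = i then k else s.arr b j := by
  by_cases hb : b = a
  · subst hb
    simp [State.setArr, Function.update_apply]
  · simp [State.setArr, hb]

/-- All numbers in the state are less than `N` in magnitude. -/
structure State.Small (N : ℤ) (s : State) : Prop where
  var : ∀ x, |s.var x| < N
  arr : ∀ a i, |s.arr a i| < N

theorem State.Small.setVar {N : ℤ} {s : State} (hs : s.Small N) {x : ℕ} {k : ℤ} (hk : |k| < N) :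
    (s.setVar x k).Small N where
  var y := by
    rw [setVar_var]
    split_ifs
    · exact hk
    · exact hs.var y
  arr := hs.arr

theorem State.Small.setArr {N : ℤ} {s : State} (hs : s.Small N) {a : ℕ} {i k : ℤ} (hk : |k| < N) :
    (s.setArr a i k).Small N where
  var := hs.var
  arr b j := by
    rw [setArr_arr]
    split_ifs
    · exact hk
    · exact hs.arr b j

theorem abs_add_lt_pow {N a b : ℤ} {j k : ℕ} (hN : 2 ≤ N) (ha : |a| < N ^ j) (hb : |b| < N ^ k) :
    |a| + |b| < N ^ (max j k + 1) := by
  have h1 : N ^ j ≤ N ^ max j k := pow_le_pow_right₀ (by omega) (le_max_left _ _)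
  have h2 : N ^ k ≤ N ^ max j k := pow_le_pow_right₀ (by omega) (le_max_right _ _)
  have h3 : 0 < N ^ max j k := pow_pos (by omega) _
  rw [pow_succ]
  nlinarith

theorem abs_ediv_le_abs (a b : ℤ) : |a / b| ≤ |a| := by
  rw [Int.abs_eq_natAbs, Int.abs_eq_natAbs]
  exact_mod_cast Int.natAbs_ediv_le_natAbs a b

theorem Term.eval_lt {N : ℤ} (hN : 2 ≤ N) {s : State} (hs : s.Small N) (e : Term) :
    |e.eval s| < N ^ e.weight ∧ 1 ≤ e.weight := by
  induction e with
  | const k =>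
    refine ⟨?_, by simp [weight]⟩
    have h1 : k.natAbs + 1 < 2 ^ (k.natAbs + 1) := Nat.lt_two_pow_self
    have h2 : (2 : ℤ) ^ (k.natAbs + 1) ≤ N ^ (k.natAbs + 1) :=
      pow_le_pow_left₀ (by norm_num) hN _
    have h3 : ((k.natAbs + 1 : ℕ) : ℤ) < 2 ^ (k.natAbs + 1) := by exact_mod_cast h1
    simp only [eval, weight]
    rw [Int.abs_eq_natAbs]
    push_cast at h3 ⊢
    linarith
  | var x => exact ⟨by simpa [eval, weight] using hs.var x, le_rfl⟩
  | read a i ih =>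
    refine ⟨lt_of_lt_of_le (hs.arr a _) ?_, ih.2⟩
    exact le_self_pow₀ (by omega) (by have := ih.2; simp only [weight]; omega)
  | add e f he hf =>
    exact ⟨(abs_add_le _ _).trans_lt (abs_add_lt_pow hN he.1 hf.1), by simp [weight]⟩
  | sub e f he hf =>
    exact ⟨(abs_sub _ _).trans_lt (abs_add_lt_pow hN he.1 hf.1), by simp [weight]⟩
  | mul e f he hf =>
    refine ⟨?_, by have := he.2; simp only [weight]; omega⟩
    simp only [eval, weight, abs_mul, pow_add]
    exact mul_lt_mul'' he.1 hf.1 (abs_nonneg _) (abs_nonneg _)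
  | div e f he hf =>
    refine ⟨lt_of_le_of_lt (abs_ediv_le_abs _ _) (lt_of_lt_of_le he.1 ?_),
      he.2.trans (le_max_left _ _)⟩
    exact pow_le_pow_right₀ (by omega) (le_max_left _ _)

/-- No subterm weighs more than the whole term, so one inequality covers all intermediate values.
Weights depend only on the program text, hence the word length is a fixed multiple of the length of
the stored numbers. -/
theorem Term.fits {N : ℤ} (hN : 2 ≤ N) {s : State} (hs : s.Small N) {w : ℕ} (e : Term)
    (he : N ^ e.weight ≤ 2 ^ w) : e.Fits w s := by
  have hp : ∀ {i j : ℕ}, i ≤ j → N ^ i ≤ N ^ j := fun h => pow_le_pow_right₀ (by omega) h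
  have hl := (e.eval_lt hN hs).1.trans_le he
  induction e with
  | const k => exact hl
  | var x => exact hl
  | read a i ih => exact ⟨ih he ((i.eval_lt hN hs).1.trans_le he), hl⟩
  | add e f ihe ihf =>
    have h1 := (hp ((le_max_left e.weight f.weight).trans (Nat.le_succ _))).trans he
    have h2 := (hp ((le_max_right e.weight f.weight).trans (Nat.le_succ _))).trans he
    exact ⟨ihe h1 ((e.eval_lt hN hs).1.trans_le h1), ihf h2 ((f.eval_lt hN hs).1.trans_le h2), hl⟩
  | sub e f ihe ihf =>
    have h1 := (hp ((le_max_left e.weight f.weight).trans (Nat.le_succ _))).trans he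
    have h2 := (hp ((le_max_right e.weight f.weight).trans (Nat.le_succ _))).trans he
    exact ⟨ihe h1 ((e.eval_lt hN hs).1.trans_le h1), ihf h2 ((f.eval_lt hN hs).1.trans_le h2), hl⟩
  | mul e f ihe ihf =>
    have h1 := (hp (Nat.le_add_right e.weight f.weight)).trans he
    have h2 := (hp (Nat.le_add_left f.weight e.weight)).trans he
    exact ⟨ihe h1 ((e.eval_lt hN hs).1.trans_le h1), ihf h2 ((f.eval_lt hN hs).1.trans_le h2), hl⟩
  | div e f ihe ihf =>
    have h1 := (hp (le_max_left e.weight f.weight)).trans he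
    have h2 := (hp (le_max_right e.weight f.weight)).trans he
    exact ⟨ihe h1 ((e.eval_lt hN hs).1.trans_le h1), ihf h2 ((f.eval_lt hN hs).1.trans_le h2), hl⟩

theorem Exec.var_eq {w : ℕ} {p : Program} {s s' : State} {t : ℕ} (h : Exec w p s s' t) {x : ℕ}
    (hx : x ∉ p.vars) : s'.var x = s.var x := by
  induction h with
  | skip => rfl
  | assign s y e => simp_all [Program.vars]
  | write => rfl
  | seq _ _ ih1 ih2 => simp_all [Program.vars]
  | branch_pos _ _ _ ih => simp_all [Program.vars]
  | branch_neg _ _ _ ih => simp_all [Program.vars]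
  | loop_done => rfl
  | loop_step _ _ _ _ ih1 ih2 => exact (ih2 hx).trans (ih1 hx)

theorem Exec.arr_eq {w : ℕ} {p : Program} {s s' : State} {t : ℕ} (h : Exec w p s s' t) {a : ℕ}
    (ha : a ∉ p.arrs) : s'.arr a = s.arr a := by
  induction h with
  | skip => rfl
  | assign => rfl
  | write s b i e =>
    funext j
    simp_all [Program.arrs]
  | seq _ _ ih1 ih2 => simp_all [Program.arrs]
  | branch_pos _ _ _ ih => simp_all [Program.arrs]
  | branch_neg _ _ _ ih => simp_all [Program.arrs]
  | loop_done => rfl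
  | loop_step _ _ _ _ ih1 ih2 => exact (ih2 ha).trans (ih1 ha)

/-! ### Rules for total correctness with time bounds -/

/-- The word length `w` suffices to evaluate expressions of weight at most `16` over numbers less
than `N` in magnitude. -/
structure Bound (w : ℕ) (N : ℤ) : Prop where
  two_le : 2 ≤ N
  pow_le : N ^ 16 ≤ 2 ^ w

theorem Bound.fits {w : ℕ} {N : ℤ} (hb : Bound w N) {s : State} (hs : s.Small N) {e : Term}
    (he : e.weight ≤ 16) : e.Fits w s :=
  e.fits hb.two_le hs ((pow_le_pow_right₀ (by linarith [hb.two_le]) he).trans hb.pow_le)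

/-- The program `p` started in `s` halts after at most `t` steps in a state that satisfies `R`, all
of whose numbers are less than `N` in magnitude. -/
def Runs (w : ℕ) (N : ℤ) (p : Program) (s : State) (t : ℕ) (R : State → Prop) : Prop :=
  ∃ s' k, Exec w p s s' k ∧ k ≤ t ∧ s'.Small N ∧ R s'

section

variable {w : ℕ} {N : ℤ} {s : State} {p q : Program} {t : ℕ} {R : State → Prop}

theorem Runs.mono {t' : ℕ} {R' : State → Prop} (h : Runs w N p s t R) (ht : t ≤ t')
    (hR : ∀ s', s'.Small N → R s' → R' s') : Runs w N p s t' R' := by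
  obtain ⟨s', k, h1, h2, h3, h4⟩ := h
  exact ⟨s', k, h1, h2.trans ht, h3, hR s' h3 h4⟩

/-- What the program does not assign keeps its value. -/
theorem Runs.frame (h : Runs w N p s t R) :
    Runs w N p s t fun s' => R s' ∧ (∀ x, x ∉ p.vars → s'.var x = s.var x) ∧
      ∀ a, a ∉ p.arrs → s'.arr a = s.arr a := by
  obtain ⟨s', k, h1, h2, h3, h4⟩ := h
  exact ⟨s', k, h1, h2, h3, h4, fun x hx => h1.var_eq hx, fun a ha => h1.arr_eq ha⟩

theorem Runs.skip (hs : s.Small N) (hR : R s) (ht : 1 ≤ t) : Runs w N Program.skip s t R :=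
  ⟨s, 1, Exec.skip s, ht, hs, hR⟩

theorem Runs.assign (hb : Bound w N) (hs : s.Small N) {x : ℕ} {e : Term} (he : e.weight ≤ 16)
    (ht : e.cost + 1 ≤ t) (hk : |e.eval s| < N) (hR : R (s.setVar x (e.eval s))) :
    Runs w N (Program.assign x e) s t R :=
  ⟨_, _, Exec.assign s x e (hb.fits hs he), ht, hs.setVar hk, hR⟩

theorem Runs.write (hb : Bound w N) (hs : s.Small N) {a : ℕ} {i e : Term} (hi : i.weight ≤ 16)
    (he : e.weight ≤ 16) (ht : i.cost + e.cost + 1 ≤ t) (hk : |e.eval s| < N)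
    (hR : R (s.setArr a (i.eval s) (e.eval s))) : Runs w N (Program.write a i e) s t R :=
  ⟨_, _, Exec.write s a i e (hb.fits hs hi) (hb.fits hs he), ht, hs.setArr hk, hR⟩

theorem Runs.seq {t₁ t₂ : ℕ} {R₁ : State → Prop} (hp : Runs w N p s t₁ R₁)
    (hq : ∀ s', s'.Small N → R₁ s' → Runs w N q s' t₂ R) :
    Runs w N (Program.seq p q) s (t₁ + t₂) R := by
  obtain ⟨s', k, h1, h2, h3, h4⟩ := hp
  obtain ⟨s'', k', h1', h2', h3', h4'⟩ := hq s' h3 h4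
  exact ⟨s'', k + k', Exec.seq h1 h1', add_le_add h2 h2', h3', h4'⟩

theorem Runs.assign_seq (hb : Bound w N) (hs : s.Small N) {x : ℕ} {e : Term} (he : e.weight ≤ 16)
    (ht : e.cost + 1 ≤ t) (hk : |e.eval s| < N)
    (hq : (s.setVar x (e.eval s)).Small N →
      Runs w N q (s.setVar x (e.eval s)) (t - (e.cost + 1)) R) :
    Runs w N (Program.seq (Program.assign x e) q) s t R := by
  have h := (Runs.assign (R := fun s' => s' = s.setVar x (e.eval s)) hb hs he le_rfl hk rfl).seq
    (q := q) (t₂ := t - (e.cost + 1)) (R := R) (by rintro s' hs' rfl; exact hq hs')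
  exact h.mono (by omega) fun _ _ h => h

theorem Runs.write_seq (hb : Bound w N) (hs : s.Small N) {a : ℕ} {i e : Term}
    (hi : i.weight ≤ 16) (he : e.weight ≤ 16) (ht : i.cost + e.cost + 1 ≤ t)
    (hk : |e.eval s| < N)
    (hq : (s.setArr a (i.eval s) (e.eval s)).Small N →
      Runs w N q (s.setArr a (i.eval s) (e.eval s)) (t - (i.cost + e.cost + 1)) R) :
    Runs w N (Program.seq (Program.write a i e) q) s t R := by
  have h := (Runs.write (R := fun s' => s' = s.setArr a (i.eval s) (e.eval s)) hb hs hi he le_rfl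
    hk rfl).seq (q := q) (t₂ := t - (i.cost + e.cost + 1)) (R := R)
    (by rintro s' hs' rfl; exact hq hs')
  exact h.mono (by omega) fun _ _ h => h

theorem Runs.branch (hb : Bound w N) (hs : s.Small N) {e : Term} (he : e.weight ≤ 16)
    (hp : 0 < e.eval s → Runs w N p s t R) (hq : e.eval s ≤ 0 → Runs w N q s t R) :
    Runs w N (Program.branch e p q) s (e.cost + 1 + t) R := by
  rcases lt_or_ge 0 (e.eval s) with h | h
  · obtain ⟨s', k, h1, h2, h3⟩ := hp h
    exact ⟨s', _, Exec.branch_pos (hb.fits hs he) h h1, by omega, h3⟩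
  · obtain ⟨s', k, h1, h2, h3⟩ := hq h
    exact ⟨s', _, Exec.branch_neg (hb.fits hs he) h h1, by omega, h3⟩

/-- The index of the invariant bounds the number of remaining rounds. It may drop by more than one,
so a logarithmic estimate can be put into the invariant itself. -/
theorem Runs.loop (hb : Bound w N) {e : Term} (he : e.weight ≤ 16) (I : ℕ → State → Prop)
    (hstep : ∀ k s, s.Small N → I k s → 0 < e.eval s →
      ∃ j < k, Runs w N p s t (I j)) (k : ℕ) (hs : s.Small N) (hI : I k s) :
    Runs w N (Program.loop e p) s (k * (t + e.cost + 1) + e.cost + 1)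
      fun s' => (∃ j, I j s') ∧ e.eval s' ≤ 0 := by
  induction k using Nat.strong_induction_on generalizing s with
  | _ k ih =>
    rcases lt_or_ge 0 (e.eval s) with h | h
    · obtain ⟨j, hj, s', c, h1, h2, h3, h4⟩ := hstep k s hs hI h
      obtain ⟨s'', c', h1', h2', h3', h4'⟩ := ih j hj h3 h4
      refine ⟨s'', _, Exec.loop_step (hb.fits hs he) h h1 h1', ?_, h3', h4'⟩
      have : (j + 1) * (t + e.cost + 1) ≤ k * (t + e.cost + 1) := Nat.mul_le_mul_right _ hj
      rw [add_mul] at this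
      omega
    · exact ⟨s, _, Exec.loop_done (hb.fits hs he) h, by omega, hs, ⟨k, hI⟩, h⟩

/-- A loop that counts the variable `x` up to the value of `e`, with `e - x` as its test. -/
theorem Runs.countLoop (hb : Bound w N) {e : Term} {x : ℕ} (he : (e.sub (Term.var x)).weight ≤ 16)
    (n : ℕ) (I : ℕ → State → Prop) (hx : ∀ i s, I i s → s.var x = i ∧ e.eval s = n)
    (hstep : ∀ i s, s.Small N → I i s → i < n → Runs w N p s t (I (i + 1)))
    (hs : s.Small N) (hI : I 0 s) :
    Runs w N (Program.loop (e.sub (Term.var x)) p) s (n * (t + e.cost + 3) + e.cost + 3) (I n) := by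
  have h := Runs.loop (p := p) (s := s) (t := t) hb he
    (fun k s => ∃ i, i ≤ n ∧ k = n - i ∧ I i s) (by
      rintro k s hs ⟨i, hi, rfl, hIi⟩ hpos
      obtain ⟨h1, h2⟩ := hx i s hIi
      simp only [Term.eval, h1, h2] at hpos
      refine ⟨n - (i + 1), by omega, ?_⟩
      exact (hstep i s hs hIi (by omega)).mono le_rfl fun s' _ h => ⟨i + 1, by omega, rfl, h⟩)
    n hs ⟨0, by omega, by omega, hI⟩
  refine h.mono (by simp only [Term.cost]; ring_nf; omega) ?_
  rintro s' - ⟨⟨k, i, hi, -, hIi⟩, hle⟩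
  obtain ⟨h1, h2⟩ := hx i s' hIi
  simp only [Term.eval, h1, h2] at hle
  obtain rfl : i = n := by omega
  exact hIi

end

end RAM

/-! ### Euclid's algorithm and the common denominator -/

namespace RAM

open Term Program

/-- Euclid's algorithm: replaces variable `4` by the greatest common divisor of the variables `4`
and `5`. -/
def euclid : Program :=
  loop (var 5) (seq (assign 6 (sub (var 4) (mul (div (var 4) (var 5)) (var 5))))
    (seq (assign 4 (var 5)) (assign 5 (var 6))))

/-- For 0 < y ≤ x one has x ≥ y + x % y ≥ 2 (x % y), so a division at least halves the product of
the two numbers. The first division is counted separately, because x may be negative, less than y or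
very large; afterwards the product is at most y². Thus the time depends on y alone. -/
theorem runs_euclid {w : ℕ} {N : ℤ} (hb : Bound w N) {s : State} (hs : s.Small N)
    (hy : 0 < s.var 5) {l : ℕ} (hl : s.var 5 < 2 ^ l) :
    Runs w N euclid s (14 * (2 * l + 1) + 2)
      fun s' => s'.var 4 = Int.gcd (s.var 4) (s.var 5) := by
  have h := Runs.loop (e := var 5) (t := 12) (s := s)
    (p := seq (assign 6 (sub (var 4) (mul (div (var 4) (var 5)) (var 5))))
      (seq (assign 4 (var 5)) (assign 5 (var 6)))) hb (by decide)
    (fun k s' => 0 ≤ s'.var 5 ∧ Int.gcd (s'.var 4) (s'.var 5) = Int.gcd (s.var 4) (s.var 5) ∧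
      ((s'.var 5 ≤ s'.var 4 ∧ s'.var 4 * s'.var 5 < 2 ^ k) ∨
        (0 < s'.var 5 ∧ ∃ j, k = j + 1 ∧ s'.var 5 * s'.var 5 < 2 ^ j))) ?_ (2 * l + 1) hs ?_
  · refine h.mono (by simp only [Term.cost]; omega) ?_
    rintro s' hs' ⟨⟨k, h0, hg, h1⟩, hle⟩
    simp only [Term.eval] at hle
    have h5 : s'.var 5 = 0 := by omega
    rw [← hg, h5, Int.gcd_zero_right, Int.natCast_natAbs]
    rcases h1 with ⟨h1, -⟩ | ⟨h1, -⟩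
    · rw [abs_of_nonneg (by omega)]
    · omega
  · rintro k s' hs' ⟨h0, hg, h1⟩ hpos
    simp only [Term.eval] at hpos
    set x := s'.var 4
    set y := s'.var 5
    have hmod : x - x / y * y = x % y := by rw [Int.emod_def, mul_comm]
    have hr0 := Int.emod_nonneg x hpos.ne'
    have hr1 := Int.emod_lt_of_pos x hpos
    have hyN := abs_lt.mp (hs'.var 5)
    obtain ⟨j, hj, hlt⟩ : ∃ j < k, y * (x % y) < 2 ^ j := by
      rcases h1 with ⟨hyx, hxy⟩ | ⟨-, j, rfl, hj⟩
      · obtain _ | j := k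
        · exfalso
          rw [pow_zero] at hxy
          nlinarith
        · refine ⟨j, by omega, ?_⟩
          have h2 : 1 ≤ x / y := (Int.le_ediv_iff_mul_le hpos).mpr (by linarith)
          have h3 : y * (x / y) + x % y = x := Int.mul_ediv_add_emod x y
          have h4 : y + x % y ≤ x := by nlinarith
          have h5 := mul_le_mul_of_nonneg_left h4 h0
          have h6 := mul_le_mul_of_nonneg_left hr1.le h0
          rw [pow_succ] at hxy
          linarith
      · exact ⟨j, by omega, by nlinarith⟩
    refine ⟨j, hj, ?_⟩
    have hr : |x % y| < N := abs_lt.mpr ⟨by omega, by omega⟩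
    have he : eval s' (sub (var 4) (mul (div (var 4) (var 5)) (var 5))) = x % y := hmod
    refine Runs.assign_seq hb hs' (by decide) (by decide) (by rwa [he]) fun hs₁ => ?_
    refine Runs.assign_seq hb hs₁ (by decide) (by decide) (hs₁.var _) fun hs₂ => ?_
    refine Runs.assign hb hs₂ (by decide) (by decide) (hs₂.var _) ?_
    have e5 : s'.var 5 = y := rfl
    rw [he]
    simp only [State.setVar_var, Term.eval, e5, Nat.reduceEqDiff, reduceIte]
    refine ⟨hr0, ?_, Or.inl ⟨hr1.le, hlt⟩⟩
    rw [← hg, Int.gcd_comm y, Int.gcd_emod]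
  · refine ⟨hy.le, rfl, Or.inr ⟨hy, 2 * l, rfl, ?_⟩⟩
    rw [two_mul, pow_add]
    nlinarith

/-- The common denominator of the starting values up to the index in variable `2` is kept in
variable `3`. -/
def lcmStep : Program :=
  seq (assign 4 (var 3)) (seq (assign 5 (read 3 (var 2))) (seq euclid
    (seq (assign 3 (mul (div (var 3) (var 4)) (read 3 (var 2))))
      (assign 2 (add (var 2) (const 1))))))

/-- Computes the least common denominator in variable `3`. -/
def lcmLoop : Program :=
  seq (assign 3 (const 1)) (seq (assign 2 (const 0)) (loop (sub (var 0) (var 2)) lcmStep))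

/-- The state contains the input: the number of functions and the arrays that describe them. -/
structure HasInput {n : ℕ} (M : Fin n → Fin n × Fin n) (c : Fin n → ℚ) (s : State) : Prop where
  size : s.var 0 = n
  fst : ∀ v : Fin n, s.arr 0 (v : ℕ) = ((M v).1 : ℕ)
  snd : ∀ v : Fin n, s.arr 1 (v : ℕ) = ((M v).2 : ℕ)
  num : ∀ v : Fin n, s.arr 2 (v : ℕ) = (c v).num
  den : ∀ v : Fin n, s.arr 3 (v : ℕ) = (c v).den

theorem hasInput_inputState {n : ℕ} (M : Fin n → Fin n × Fin n) (c : Fin n → ℚ) :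
    HasInput M c (inputState M c) := by
  constructor <;> simp [inputState]

section

variable {n : ℕ} {M : Fin n → Fin n × Fin n} {c : Fin n → ℚ} {w : ℕ} {N : ℤ} {s s' : State}

theorem HasInput.of_eq (h : HasInput M c s) (h0 : s'.var 0 = s.var 0)
    (ha : ∀ a < 4, s'.arr a = s.arr a) : HasInput M c s' where
  size := h0.trans h.size
  fst := by rw [ha 0 (by norm_num)]; exact h.fst
  snd := by rw [ha 1 (by norm_num)]; exact h.snd
  num := by rw [ha 2 (by norm_num)]; exact h.num
  den := by rw [ha 3 (by norm_num)]; exact h.den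

theorem den_dvd_commonDen (c : Fin n → ℚ) (v : Fin n) : (c v).den ∣ commonDen c :=
  Finset.dvd_lcm (f := fun v => (c v).den) (Finset.mem_univ v)

theorem commonDen_pos (c : Fin n → ℚ) : 0 < commonDen c := by
  rw [Nat.pos_iff_ne_zero, commonDen, Ne, Finset.lcm_eq_zero_iff]
  rintro ⟨v, -, hv⟩
  exact (c v).den_nz hv

/-- Every partial common multiple divides the final one and therefore stays below `2 ^ l`. -/
theorem runs_lcmStep (hb : Bound w N) (hs : s.Small N) (hin : HasInput M c s)
    (hN : (n : ℤ) + 1 < N) {l : ℕ} (hl : commonDen c < 2 ^ l) (hlN : (2 : ℤ) ^ l ≤ N) {i : ℕ}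
    (hi : i < n) {D : ℕ} (h2 : s.var 2 = i) (h3 : s.var 3 = D) (hD : D ∣ commonDen c) :
    Runs w N lcmStep s (28 * l + 50) fun s' =>
      HasInput M c s' ∧ s'.var 2 = (i + 1 : ℕ) ∧ s'.var 3 = (Nat.lcm D (c ⟨i, hi⟩).den : ℕ) := by
  have hden := hin.den ⟨i, hi⟩
  simp only at hden
  have hdle := Nat.le_of_dvd (commonDen_pos c) (den_dvd_commonDen c ⟨i, hi⟩)
  refine Runs.mono (t := 28 * l + 16 + 34) (R := _) ?_ (by omega) fun _ _ h => h
  refine Runs.assign_seq hb hs (by decide) (by simp [Term.cost]) (hs.var _) fun hs₁ => ?_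
  refine Runs.assign_seq hb hs₁ (by decide) (by simp [Term.cost]) (hs₁.arr _ _)
    fun hs₂ => ?_
  have h5 : (((s.setVar 4 (eval s (var 3))).setVar 5
      (eval (s.setVar 4 (eval s (var 3))) (read 3 (var 2)))).var 5) = (c ⟨i, hi⟩).den := by
    simp [Term.eval, h2, hden]
  have h4 : (((s.setVar 4 (eval s (var 3))).setVar 5
      (eval (s.setVar 4 (eval s (var 3))) (read 3 (var 2)))).var 4) = D := by
    simp [Term.eval, h3]
  have heu := (runs_euclid hb hs₂ (by rw [h5]; exact_mod_cast (c ⟨i, hi⟩).den_pos)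
    (l := l) (by rw [h5]; exact_mod_cast hdle.trans_lt hl)).frame
  refine Runs.mono (t := 14 * (2 * l + 1) + 2 + 13) ?_ (by simp [Term.cost]; omega)
    fun _ _ h => h
  refine heu.seq fun s₃ hs₃ hR => ?_
  obtain ⟨hg, hv, ha⟩ := hR
  rw [h4, h5] at hg
  simp only [Int.gcd_natCast_natCast] at hg
  have hv0 : s₃.var 0 = s.var 0 := by rw [hv 0 (by decide)]; simp
  have hv2 : s₃.var 2 = i := by rw [hv 2 (by decide)]; simp [h2]
  have hv3 : s₃.var 3 = D := by rw [hv 3 (by decide)]; simp [h3]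
  have ha' : ∀ a, s₃.arr a = s.arr a := fun a => by rw [ha a (by simp [euclid, arrs])]; rfl
  have hval : eval s₃ (mul (div (var 3) (var 4)) (read 3 (var 2)))
      = (Nat.lcm D (c ⟨i, hi⟩).den : ℕ) := by
    simp only [Term.eval, hv2, hv3, ha', hden, hg]
    rw [Nat.lcm_eq_mul_div, ← Nat.div_mul_right_comm (Nat.gcd_dvd_left _ _)]
    push_cast
    rfl
  have hlcm := Nat.le_of_dvd (commonDen_pos c) (Nat.lcm_dvd hD (den_dvd_commonDen c ⟨i, hi⟩))
  have hlcm' : ((Nat.lcm D (c ⟨i, hi⟩).den : ℕ) : ℤ) < N :=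
    lt_of_lt_of_le (by exact_mod_cast hlcm.trans_lt hl) hlN
  refine Runs.assign_seq hb hs₃ (by decide) (by decide)
    (by rw [hval, Nat.abs_cast]; exact hlcm') fun hs₄ => ?_
  rw [hval] at hs₄ ⊢
  refine Runs.assign hb hs₄ (by decide) (by decide) ?_ ⟨hin.of_eq ?_ ?_, ?_, ?_⟩
  · simp only [Term.eval, State.setVar_var, hv2]
    norm_num
    rw [abs_of_nonneg (by omega)]
    omega
  · simp [hv0]
  · intro a _
    simp [ha']
  · simp [Term.eval, hv2]
  · simp

theorem runs_lcmLoop (hb : Bound w N) (hs : s.Small N) (hin : HasInput M c s)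
    (hN : (n : ℤ) + 1 < N) {l : ℕ} (hl : commonDen c < 2 ^ l) (hlN : (2 : ℤ) ^ l ≤ N) :
    Runs w N lcmLoop s (n * (28 * l + 54) + 8) fun s' =>
      HasInput M c s' ∧ s'.var 3 = commonDen c := by
  have hb2 := hb.two_le
  refine Runs.assign_seq hb hs (by decide) (by simp [Term.cost]) (by simp [Term.eval]; omega)
    fun hs₁ => ?_
  refine Runs.assign_seq hb hs₁ (by decide) (by simp [Term.cost]) (by simp [Term.eval]; omega)
    fun hs₂ => ?_
  have h := Runs.countLoop (e := var 0) (x := 2) (p := lcmStep) hb (by decide) n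
    (fun i s' => HasInput M c s' ∧ s'.var 2 = i ∧ ∃ D : ℕ, s'.var 3 = D ∧ D ∣ commonDen c ∧
      ∀ v : Fin n, (v : ℕ) < i → (c v).den ∣ D)
    (fun i s' h => ⟨h.2.1, h.1.size⟩)
    (fun i s' hs' ⟨h1, h2, D, h3, h4, h5⟩ hi =>
      (runs_lcmStep hb hs' h1 hN hl hlN hi h2 h3 h4).mono le_rfl
        fun s'' _ ⟨g1, g2, g3⟩ => ⟨g1, g2, _, g3,
          Nat.lcm_dvd h4 (den_dvd_commonDen c _), fun v hv => by
            rcases Nat.lt_succ_iff_lt_or_eq.mp hv with hv | hv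
            · exact (h5 v hv).trans (Nat.dvd_lcm_left _ _)
            · obtain rfl : v = ⟨i, hi⟩ := Fin.ext hv
              exact Nat.dvd_lcm_right _ _⟩) hs₂
    ⟨hin.of_eq (by simp) (by simp), by simp [Term.eval], 1, by simp [Term.eval], one_dvd _,
      by simp⟩
  refine h.mono (by simp [Term.cost]) ?_
  rintro s' - ⟨h1, h2, D, h3, h4, h5⟩
  refine ⟨h1, ?_⟩
  rw [h3]
  congr 1
  exact Nat.dvd_antisymm h4 (Finset.lcm_dvd fun v _ => h5 v v.2)

end

end RAM

/-! ### Scaled starting values and the initial search interval -/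

namespace RAM

open Term Program

/-- The starting value of `v`, multiplied by the least common denominator. -/
def scaledStart {n : ℕ} (c : Fin n → ℚ) (v : Fin n) : ℤ :=
  (c v).num * ((commonDen c / (c v).den : ℕ) : ℤ)

theorem commonDen_mul {n : ℕ} (c : Fin n → ℚ) (v : Fin n) :
    (commonDen c : ℚ) * c v = scaledStart c v := by
  obtain ⟨k, hk⟩ := den_dvd_commonDen c v
  have hd : ((c v).den : ℚ) ≠ 0 := by exact_mod_cast (c v).den_nz
  have h : (c v) * ((c v).den : ℚ) = (c v).num := Rat.mul_den_eq_num (c v)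
  rw [scaledStart, hk, Nat.mul_div_cancel_left _ (c v).den_pos]
  push_cast
  rw [← h]
  ring

theorem natAbs_scaledStart_le {n : ℕ} (c : Fin n → ℚ) (v : Fin n) :
    (scaledStart c v).natAbs ≤ scaledMax c := by
  have h := Finset.le_sup (f := fun v => ((commonDen c : ℚ) * c v).num.natAbs) (Finset.mem_univ v)
  simp only [commonDen_mul, Rat.num_intCast] at h
  simpa [scaledMax, commonDen_mul] using h

/-- One round of `scaleLoop`. -/
def scaleStep : Program :=
  seq (write 4 (var 2) (mul (read 2 (var 2)) (div (var 3) (read 3 (var 2)))))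
    (seq (assign 7 (add (var 7) (mul (read 4 (var 2)) (read 4 (var 2)))))
      (seq (assign 8 (add (var 8) (var 8))) (assign 2 (add (var 2) (const 1)))))

/-- Writes the scaled starting values into array `4`, an upper bound of their magnitudes into
variable `7`, and `2 ^ n` into variable `8`. -/
def scaleLoop : Program :=
  seq (assign 2 (const 0)) (seq (assign 7 (const 1)) (seq (assign 8 (const 1))
    (loop (sub (var 0) (var 2)) scaleStep)))

/-- The state contains the input, the common denominator and the scaled starting values. -/
structure HasScaled {n : ℕ} (M : Fin n → Fin n × Fin n) (c : Fin n → ℚ) (s : State) : Prop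
    extends HasInput M c s where
  commonDen : s.var 3 = commonDen c
  start : ∀ v : Fin n, s.arr 4 (v : ℕ) = scaledStart c v

section

variable {n : ℕ} {M : Fin n → Fin n × Fin n} {c : Fin n → ℚ} {w : ℕ} {N : ℤ} {s s' : State}

theorem HasScaled.of_eq (h : HasScaled M c s) (h0 : s'.var 0 = s.var 0)
    (h3 : s'.var 3 = s.var 3) (ha : ∀ a < 5, s'.arr a = s.arr a) : HasScaled M c s' where
  toHasInput := h.toHasInput.of_eq h0 fun a h => ha a (by omega)
  commonDen := h3.trans h.commonDen
  start := by rw [ha 4 (by norm_num)]; exact h.start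

/-- Variable `7` sums squares, since |x| ≤ x² for integers: started at 1, it strictly exceeds all
magnitudes without any test of signs, and still has only O(n + ℓ) bits. -/
theorem runs_scaleStep (hb : Bound w N) (hs : s.Small N) (hin : HasInput M c s)
    (h3 : s.var 3 = commonDen c) (hnN : (n : ℤ) + 1 < N) {S : ℤ}
    (hS : ∀ v, |scaledStart c v| ≤ S) (hSN : 1 + n * S ^ 2 < N) (h2N : 2 ^ n < N) {i : ℕ}
    (hi : i < n) {m : ℤ} (h2 : s.var 2 = i) (h7 : s.var 7 = m) (hm : 1 ≤ m)
    (hmS : m ≤ 1 + i * S ^ 2) (h8 : s.var 8 = 2 ^ i) :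
    Runs w N scaleStep s 28 fun s' => HasInput M c s' ∧ s'.var 2 = (i + 1 : ℕ) ∧
      s'.var 3 = commonDen c ∧ s'.var 7 = m + scaledStart c ⟨i, hi⟩ ^ 2 ∧ s'.var 8 = 2 ^ (i + 1) ∧
      s'.arr 4 i = scaledStart c ⟨i, hi⟩ ∧ ∀ j : ℤ, j ≠ i → s'.arr 4 j = s.arr 4 j := by
  have hnum := hin.num ⟨i, hi⟩
  have hden := hin.den ⟨i, hi⟩
  simp only at hnum hden
  set x := scaledStart c ⟨i, hi⟩ with hx
  have hxS : |x| ≤ S := hS _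
  have hx2 : x ^ 2 ≤ S ^ 2 := sq_le_sq' (by linarith [(abs_le.mp hxS).1]) (abs_le.mp hxS).2
  have hiS : ((i : ℤ) + 1) * S ^ 2 ≤ n * S ^ 2 :=
    mul_le_mul_of_nonneg_right (by exact_mod_cast hi) (sq_nonneg S)
  have hmx : m + x ^ 2 ≤ 1 + n * S ^ 2 := by linarith
  have hxN : |x| < N := by
    have : |x| ≤ x ^ 2 := by
      rw [← sq_abs]
      exact Int.le_self_sq _
    linarith
  have hpow : (2 : ℤ) ^ (i + 1) ≤ 2 ^ n := pow_le_pow_right₀ (by norm_num) hi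
  have h2i : (0 : ℤ) < 2 ^ i := by positivity
  have hval : eval s (mul (read 2 (var 2)) (div (var 3) (read 3 (var 2)))) = x := by
    simp only [Term.eval, h2, h3, hnum, hden, hx, scaledStart]
    push_cast
    rfl
  refine Runs.write_seq hb hs (by decide) (by decide) (by decide) (by rwa [hval]) fun hs₁ => ?_
  rw [hval] at hs₁ ⊢
  have hs₁7 : eval (s.setArr 4 (eval s (var 2)) x)
      (add (var 7) (mul (read 4 (var 2)) (read 4 (var 2)))) = m + x ^ 2 := by
    simp [Term.eval, h2, h7, sq]
  refine Runs.assign_seq hb hs₁ (by decide) (by decide) (by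
    rw [hs₁7, abs_of_nonneg (by positivity)]
    linarith) fun hs₂ => ?_
  rw [hs₁7] at hs₂ ⊢
  refine Runs.assign_seq hb hs₂ (by decide) (by decide) (by
    simp [Term.eval, h8]
    rw [abs_of_nonneg (by positivity)]
    rw [pow_succ] at hpow
    linarith) fun hs₃ => ?_
  refine Runs.assign hb hs₃ (by decide) (by decide) (by
    simp [Term.eval, h2]
    rw [abs_of_nonneg (by positivity)]
    omega) ⟨hin.of_eq (by simp) fun a ha => ?_, ?_, ?_, ?_, ?_, ?_, ?_⟩
  · funext j
    simp
    omega
  · simp [Term.eval, h2]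
  · simp [h3]
  · simp
  · simp [Term.eval, h8, pow_succ, mul_two]
  · simp [Term.eval, h2]
  · intro j hj
    simp [Term.eval, h2, hj]

theorem runs_scaleLoop (hb : Bound w N) (hs : s.Small N) (hin : HasInput M c s)
    (h3 : s.var 3 = commonDen c) (hnN : (n : ℤ) + 1 < N) {S : ℤ}
    (hS : ∀ v, |scaledStart c v| ≤ S) (hSN : 1 + n * S ^ 2 < N) (h2N : 2 ^ n < N) :
    Runs w N scaleLoop s (n * 32 + 10) fun s' => HasScaled M c s' ∧ 1 ≤ s'.var 7 ∧
      (∀ v, |scaledStart c v| < s'.var 7) ∧ s'.var 7 ≤ 1 + n * S ^ 2 ∧ s'.var 8 = 2 ^ n := by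
  have hb2 := hb.two_le
  refine Runs.assign_seq hb hs (by decide) (by simp [Term.cost]) (by simp [Term.eval]; omega)
    fun hs₁ => ?_
  refine Runs.assign_seq hb hs₁ (by decide) (by simp [Term.cost]) (by simp [Term.eval]; omega)
    fun hs₂ => ?_
  refine Runs.assign_seq hb hs₂ (by decide) (by simp [Term.cost]) (by simp [Term.eval]; omega)
    fun hs₃ => ?_
  have h := Runs.countLoop (e := var 0) (x := 2) (p := scaleStep) (t := 28) hb (by decide) n
    (fun i s' => (HasInput M c s' ∧ s'.var 2 = i) ∧ s'.var 3 = commonDen c ∧ 1 ≤ s'.var 7 ∧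
      s'.var 7 ≤ 1 + i * S ^ 2 ∧ s'.var 8 = 2 ^ i ∧ ∀ v : Fin n, (v : ℕ) < i →
        s'.arr 4 (v : ℕ) = scaledStart c v ∧ |scaledStart c v| < s'.var 7)
    (fun i s' h => ⟨h.1.2, h.1.1.size⟩)
    (fun i s' hs' ⟨⟨h1, h2⟩, h3, h4, h5, h6, h7⟩ hi =>
      (runs_scaleStep hb hs' h1 h3 hnN hS hSN h2N hi h2 rfl h4 h5 h6).mono le_rfl
        fun s'' _ ⟨g1, g2, g3, g4, g5, g6, g7⟩ => by
          have hsq := sq_nonneg (scaledStart c ⟨i, hi⟩)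
          have habs := hS ⟨i, hi⟩
          have hsq' : scaledStart c ⟨i, hi⟩ ^ 2 ≤ S ^ 2 :=
            sq_le_sq' (by linarith [(abs_le.mp habs).1]) (abs_le.mp habs).2
          refine ⟨⟨g1, g2⟩, g3, by omega, ?_, g5, fun v hv => ?_⟩
          · rw [g4]
            push_cast
            linarith
          · rcases Nat.lt_succ_iff_lt_or_eq.mp hv with hv | hv
            · obtain ⟨k1, k2⟩ := h7 v hv
              rw [g7 _ (by exact_mod_cast hv.ne), g4]
              exact ⟨k1, by linarith⟩
            · obtain rfl : v = ⟨i, hi⟩ := Fin.ext hv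
              refine ⟨g6, ?_⟩
              have : |scaledStart c ⟨i, hi⟩| ≤ scaledStart c ⟨i, hi⟩ ^ 2 := by
                rw [← sq_abs]
                exact Int.le_self_sq _
              rw [g4]
              linarith) hs₃
    ⟨⟨hin.of_eq (by simp) (by simp), by simp [Term.eval]⟩, by simp [h3], by simp [Term.eval],
      by simp [Term.eval], by simp [Term.eval], by simp⟩
  refine h.mono (by simp [Term.cost]) ?_
  rintro s' - ⟨⟨h1, -⟩, h3, h4, h5, h6, h7⟩
  exact ⟨⟨h1, h3, fun v => (h7 v v.2).1⟩, h4, fun v => (h7 v v.2).2, h5, h6⟩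

/-- Determines the precision in variable `9`, a power of two as the length of the initial search
interval in variable `10`, and its left end point in variable `11`. -/
def bracket : Program :=
  seq (assign 9 (mul (mul (const 4) (const 4)) (mul (var 8) (var 8))))
    (seq (assign 10 (var 9))
      (seq (loop (sub (mul (var 7) (var 9)) (var 10)) (assign 10 (add (var 10) (var 10))))
        (seq (assign 11 (sub (const 0) (var 10))) (assign 10 (add (var 10) (var 10))))))

theorem runs_bracket (hb : Bound w N) (hs : s.Small N) (h8 : s.var 8 = 2 ^ n) {K : ℕ}
    (h7 : s.var 7 ≤ 2 ^ K) (hN : 2 ^ (K + 2 * n + 5) < N) :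
    Runs w N bracket s ((K + 1) * 10 + 28) fun s' =>
      s'.var 9 = 2 ^ (2 * n + 4) ∧ ∃ j ≤ K + 2 * n + 4, s'.var 10 = 2 ^ (j + 1) ∧
        s'.var 11 = -2 ^ j ∧ s.var 7 * 2 ^ (2 * n + 4) ≤ 2 ^ j := by
  have hpow : ∀ j ≤ K + 2 * n + 5, (2 : ℤ) ^ j < N := fun j hj =>
    (pow_le_pow_right₀ (by norm_num) hj).trans_lt hN
  -- The factor 16 appears as 4 * 4 because the constant 16 would have weight 17, more than `Bound`
  -- admits.
  have hB : eval s (mul (mul (const 4) (const 4)) (mul (var 8) (var 8)))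
      = 2 ^ (2 * n + 4) := by
    simp only [Term.eval, h8]
    ring
  refine Runs.assign_seq hb hs (by decide) (by simp [Term.cost]) (by
    rw [hB, abs_of_nonneg (by positivity)]
    exact hpow _ (by omega)) fun hs₁ => ?_
  rw [hB] at hs₁ ⊢
  refine Runs.assign_seq hb hs₁ (by decide) (by simp [Term.cost]) (hs₁.var _) fun hs₂ => ?_
  have h := Runs.loop (e := sub (mul (var 7) (var 9)) (var 10)) (t := 4)
    (p := assign 10 (add (var 10) (var 10))) hb (by decide)
    (fun k s' => s'.var 7 = s.var 7 ∧ s'.var 9 = 2 ^ (2 * n + 4) ∧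
      ∃ j, j + k = K + 2 * n + 4 ∧ s'.var 10 = 2 ^ j) ?_ K hs₂ ?_
  · refine Runs.mono ?_ (t := (K * 10 + 6) + 8) (by simp [Term.cost]; omega) fun _ _ h => h
    refine Runs.seq (h.mono (by simp [Term.cost]) fun _ _ h => h) ?_
    rintro s₃ hs₃ ⟨⟨k, g7, g9, j, hjk, g10⟩, hle⟩
    simp only [Term.eval, g7, g9, g10] at hle
    refine Runs.assign_seq hb hs₃ (by decide) (by decide) (by
      simp only [Term.eval, g10]
      rw [zero_sub, abs_neg, abs_of_nonneg (by positivity)]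
      exact hpow _ (by omega)) fun hs₄ => ?_
    refine Runs.assign hb hs₄ (by decide) (by decide) (by
      simp [Term.eval, g10]
      rw [abs_of_nonneg (by positivity), ← two_mul, ← pow_succ']
      exact hpow _ (by omega)) ⟨by simp [g9], j, by omega, ?_, ?_, by linarith⟩
    · simp [Term.eval, g10]
      ring
    · simp [Term.eval, g10]
  · rintro k s' hs' ⟨g7, g9, j, hjk, g10⟩ hpos
    simp only [Term.eval, g7, g9, g10] at hpos
    have h2 : s.var 7 * 2 ^ (2 * n + 4) ≤ 2 ^ K * 2 ^ (2 * n + 4) :=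
      mul_le_mul_of_nonneg_right h7 (by positivity)
    rw [← pow_add] at h2
    have hj : j < K + (2 * n + 4) :=
      (pow_lt_pow_iff_right₀ (by norm_num : (1 : ℤ) < 2)).mp (by linarith)
    refine ⟨k - 1, by omega, Runs.assign hb hs' (by decide) (by decide) (by
      simp [Term.eval, g10]
      rw [abs_of_nonneg (by positivity), ← two_mul, ← pow_succ']
      exact hpow _ (by omega)) ⟨by simp [g7], by simp [g9], j + 1, by omega, ?_⟩⟩
    simp [Term.eval, g10]
    ring
  · exact ⟨by simp, by simp, 2 * n + 4, by omega, by simp [Term.eval]⟩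

end

end RAM

/-! ### The stability test -/

namespace RAM

open Term Program ReplacementSystem

/-- Writes the shifted starting value of one function into array `5`. -/
def baseStep : Program :=
  seq (write 5 (var 13) (sub (mul (read 4 (var 13)) (var 9)) (var 12)))
    (assign 13 (add (var 13) (const 1)))

/-- Computes one entry of array `5`, whose rows hold the depth-limited optima. -/
def rowStep : Program :=
  seq (assign 14 (sub (var 13) (mul (div (var 13) (var 0)) (var 0))))
    (seq (assign 6 (add (read 5 (add (sub (var 13) (var 14)) (read 0 (var 14))))
        (read 5 (add (sub (var 13) (var 14)) (read 1 (var 14))))))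
      (seq (branch (sub (var 6) (read 5 (var 14)))
          (write 5 (add (var 13) (var 0)) (var 6))
          (write 5 (add (var 13) (var 0)) (read 5 (var 14))))
        (assign 13 (add (var 13) (const 1)))))

/-- Adds the increase of one entry in the last row of array `5` to variable `15`. -/
def flagStep : Program :=
  seq (assign 15 (add (var 15) (sub (read 5 (add (var 16) (var 13)))
      (read 5 (sub (add (var 16) (var 13)) (var 0))))))
    (assign 13 (add (var 13) (const 1)))

/-- Decides the stability of the system shifted by the candidate in variable `12`: variable `15`
becomes positive if the system is unstable, and zero otherwise. -/
def check : Program :=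
  seq (assign 13 (const 0)) (seq (loop (sub (var 0) (var 13)) baseStep)
    (seq (assign 16 (add (mul (var 0) (var 0)) (var 0))) (seq (assign 13 (const 0))
      (seq (loop (sub (var 16) (var 13)) rowStep) (seq (assign 13 (const 0))
        (seq (assign 15 (const 0)) (loop (sub (var 0) (var 13)) flagStep)))))))

section

variable {n : ℕ} {M : Fin n → Fin n × Fin n} {c : Fin n → ℚ} {w : ℕ} {N : ℤ} {s s' : State}

theorem runs_baseStep (hb : Bound w N) (hs : s.Small N) (hin : HasScaled M c s)
    (hnN : (n : ℤ) < N) {a B : ℤ} (h9 : s.var 9 = B) (h12 : s.var 12 = a)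
    (hN : ∀ v, |shift (scaledStart c) a B v| < N) {i : ℕ} (hi : i < n) (h13 : s.var 13 = i) :
    Runs w N baseStep s 12 fun s' => HasScaled M c s' ∧ s'.var 9 = B ∧ s'.var 12 = a ∧
      s'.var 13 = (i + 1 : ℕ) ∧ s'.arr 5 i = shift (scaledStart c) a B ⟨i, hi⟩ ∧
      ∀ j : ℤ, j ≠ i → s'.arr 5 j = s.arr 5 j := by
  have hstart := hin.start ⟨i, hi⟩
  simp only at hstart
  have hval : eval s (sub (mul (read 4 (var 13)) (var 9)) (var 12))
      = shift (scaledStart c) a B ⟨i, hi⟩ := by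
    simp only [Term.eval, h13, h9, h12, hstart, shift]
    ring
  refine Runs.write_seq hb hs (by decide) (by decide) (by decide) (by rw [hval]; exact hN _)
    fun hs₁ => ?_
  rw [hval] at hs₁ ⊢
  refine Runs.assign hb hs₁ (by decide) (by decide) (by
    simp [Term.eval, h13]
    rw [abs_of_nonneg (by positivity)]
    omega) ⟨hin.of_eq (by simp) (by simp) fun b hb => ?_, by simp [h9], by simp [h12], ?_, ?_,
      fun j hj => ?_⟩
  · funext j
    simp
    omega
  · simp [Term.eval, h13]
  · simp [Term.eval, h13]
  · simp [Term.eval, h13, hj]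

theorem runs_baseLoop (hb : Bound w N) (hs : s.Small N) (hin : HasScaled M c s)
    (hnN : (n : ℤ) < N) {a B : ℤ} (h9 : s.var 9 = B) (h12 : s.var 12 = a) (h13 : s.var 13 = 0)
    (hN : ∀ v, |shift (scaledStart c) a B v| < N) :
    Runs w N (loop (sub (var 0) (var 13)) baseStep) s (n * 16 + 4) fun s' =>
      HasScaled M c s' ∧ ∀ v : Fin n, s'.arr 5 (v : ℕ) = shift (scaledStart c) a B v := by
  have h := Runs.countLoop (e := var 0) (x := 13) (p := baseStep) (t := 12) hb (by decide) n
    (fun i s' => HasScaled M c s' ∧ s'.var 9 = B ∧ s'.var 12 = a ∧ s'.var 13 = i ∧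
      ∀ v : Fin n, (v : ℕ) < i → s'.arr 5 (v : ℕ) = shift (scaledStart c) a B v)
    (fun i s' h => ⟨h.2.2.2.1, h.1.size⟩)
    (fun i s' hs' ⟨h1, h2, h3, h4, h5⟩ hi =>
      (runs_baseStep hb hs' h1 hnN h2 h3 hN hi h4).mono le_rfl
        fun s'' _ ⟨g1, g2, g3, g4, g5, g6⟩ => ⟨g1, g2, g3, g4, fun v hv => by
          rcases Nat.lt_succ_iff_lt_or_eq.mp hv with hv | hv
          · rw [g6 _ (by exact_mod_cast hv.ne)]
            exact h5 v hv
          · obtain rfl : v = ⟨i, hi⟩ := Fin.ext hv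
            exact g5⟩) hs ⟨hin, h9, h12, by simpa using h13, by simp⟩
  refine h.mono (by simp [Term.cost]) ?_
  rintro s' - ⟨h1, -, -, -, h5⟩
  exact ⟨h1, fun v => h5 v v.2⟩

/-- The entry with index `i` of the table of depth-limited optima, stored row by row. -/
def entry (M : Fin n → Fin n × Fin n) (b : Fin n → ℤ) (hn : 0 < n) (i : ℕ) : ℤ :=
  optimum M b (i / n) ⟨i % n, Nat.mod_lt i hn⟩

theorem entry_add (b : Fin n → ℤ) (hn : 0 < n) (k : ℕ) (v : Fin n) :
    entry M b hn (k * n + v) = optimum M b k v := by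
  have h1 : (k * n + v) / n = k := by
    rw [mul_comm, Nat.mul_add_div hn, Nat.div_eq_of_lt v.2, add_zero]
  have h2 : (k * n + v) % n = v := by
    rw [mul_comm, Nat.mul_add_mod, Nat.mod_eq_of_lt v.2]
  simp only [entry, h1, h2]

/-- Rows have length n, so entry j + n sits directly below entry j: it is computed from row j / n,
which begins at j - j % n, and from the leaf weight in row 0. -/
theorem runs_rowStep (hb : Bound w N) (hs : s.Small N) (hn : 0 < n) (hin : HasScaled M c s)
    {b : Fin n → ℤ} {D : ℤ} (hD : ∀ v, |b v| ≤ D) (hDN : 2 ^ (n + 1) * D < N)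
    (hnN : (n : ℤ) * n + n < N) {j : ℕ} (hj : j < n * n + n) (h13 : s.var 13 = j)
    (h5 : ∀ i < j + n, s.arr 5 (i : ℕ) = entry M b hn i) :
    Runs w N rowStep s 44 fun s' => HasScaled M c s' ∧ s'.var 16 = s.var 16 ∧
      s'.var 13 = (j + 1 : ℕ) ∧ ∀ i < j + 1 + n, s'.arr 5 (i : ℕ) = entry M b hn i := by
  set q := j / n with hq
  set v : Fin n := ⟨j % n, Nat.mod_lt j hn⟩ with hv
  have hjq : q * n + v = j := Nat.div_add_mod' j n
  have hqn : q ≤ n := by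
    have h := Nat.div_lt_of_lt_mul (show j < n * (n + 1) by linarith)
    omega
  have hrow : ∀ u : Fin n, s.arr 5 ((q * n + u : ℕ) : ℤ) = optimum M b q u := fun u => by
    rw [h5 _ (by have := u.2; omega), entry_add]
  have hb5 : s.arr 5 ((v : ℕ) : ℤ) = b v := by
    have h := entry_add (M := M) b hn 0 v
    rw [zero_mul, zero_add] at h
    rw [h5 _ (by have := v.2; omega), h, optimum]
  have hvj : (v : ℕ) ≤ j := Nat.mod_le j n
  have hev : eval s (sub (var 13) (mul (div (var 13) (var 0)) (var 0))) = (v : ℕ) := by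
    simp only [Term.eval, h13, hin.size]
    rw [← Int.natCast_div, ← hq]
    have : ((q * n + v : ℕ) : ℤ) = j := by rw [hjq]
    push_cast at this
    linarith
  have hvN : ((v : ℕ) : ℤ) < N := by
    have h1 := v.2
    nlinarith
  refine Runs.assign_seq hb hs (by decide) (by decide) (by rwa [hev, Nat.abs_cast]) fun hs₁ => ?_
  rw [hev] at hs₁ ⊢
  set t := optimum M b q (M v).1 + optimum M b q (M v).2 with ht
  have hidx : ∀ u : Fin n, (j : ℤ) - (v : ℕ) + (u : ℕ) = ((q * n + u : ℕ) : ℤ) := fun u => by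
    have : ((q * n + v : ℕ) : ℤ) = j := by rw [hjq]
    push_cast at this ⊢
    linarith
  have het : eval (s.setVar 14 (v : ℕ)) (add (read 5 (add (sub (var 13) (var 14))
      (read 0 (var 14)))) (read 5 (add (sub (var 13) (var 14)) (read 1 (var 14))))) = t := by
    simp only [Term.eval, State.setVar_var, State.setVar_arr, reduceIte, Nat.reduceEqDiff, h13,
      hin.fst, hin.snd, hidx, hrow, ht]
  have htN : |t| < N := by
    have h1 := abs_optimum_le M b hD q (M v).1
    have h2 := abs_optimum_le M b hD q (M v).2
    have h3 : (2 : ℤ) ^ (q + 1) ≤ 2 ^ (n + 1) := pow_le_pow_right₀ (by norm_num) (by omega)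
    have h4 := mul_le_mul_of_nonneg_right h3 ((abs_nonneg _).trans (hD v))
    have h5 := abs_add_le (optimum M b q (M v).1) (optimum M b q (M v).2)
    rw [pow_succ] at h4
    linarith
  refine Runs.assign_seq hb hs₁ (by decide) (by decide) (by rwa [het]) fun hs₂ => ?_
  rw [het] at hs₂ ⊢
  refine Runs.mono (t := (3 + 1 + 1 + 7) + 7) (R := _) ?_ (by decide) fun _ _ h => h
  refine Runs.seq (R₁ := fun s' => s' = ((s.setVar 14 (v : ℕ)).setVar 6 t).setArr 5 (j + n)
    (optimum M b (q + 1) v)) ?_ ?_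
  · refine Runs.mono (t := (sub (var 6) (read 5 (var 14))).cost + 1 + 7) (R := _) ?_ (by decide)
      fun _ _ h => h
    refine Runs.branch hb hs₂ (by decide) (fun hpos => ?_) fun hneg => ?_
    · refine Runs.write hb hs₂ (by decide) (by decide) (by decide) (by simpa [Term.eval]) ?_
      simp [Term.eval, hb5] at hpos
      simp [Term.eval, h13, hin.size, optimum, ← ht, max_eq_right hpos.le]
    · refine Runs.write hb hs₂ (by decide) (by decide) (by decide) (hs₂.arr _ _) ?_
      simp [Term.eval, hb5] at hneg
      simp [Term.eval, h13, hin.size, optimum, ← ht, hb5, max_eq_left hneg]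
  · rintro s₃ hs₃ rfl
    refine Runs.assign hb hs₃ (by decide) (by decide) (by
      simp [Term.eval, h13]
      rw [abs_of_nonneg (by positivity)]
      have : (j : ℤ) < n * n + n := by exact_mod_cast hj
      linarith) ⟨hin.of_eq (by simp) (by simp) fun b hb => ?_, by simp, ?_, fun i hi => ?_⟩
    · funext j
      simp
      omega
    · simp [Term.eval, h13]
    · rcases eq_or_ne i (j + n) with rfl | hne
      · have : entry M b hn (j + n) = optimum M b (q + 1) v := by
          rw [← entry_add (M := M) b hn (q + 1) v]
          congr 1
          rw [← hjq]
          ring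
        simp [this]
      · have hne' : (i : ℤ) ≠ (j : ℤ) + n := by exact_mod_cast hne
        simp [hne', h5 i (by omega)]

theorem runs_rowLoop (hb : Bound w N) (hs : s.Small N) (hn : 0 < n) (hin : HasScaled M c s)
    {b : Fin n → ℤ} {D : ℤ} (hD : ∀ v, |b v| ≤ D) (hDN : 2 ^ (n + 1) * D < N)
    (hnN : (n : ℤ) * n + n < N) (h13 : s.var 13 = 0) (h16 : s.var 16 = (n * n + n : ℕ))
    (h5 : ∀ v : Fin n, s.arr 5 (v : ℕ) = b v) :
    Runs w N (loop (sub (var 16) (var 13)) rowStep) s ((n * n + n) * 48 + 4) fun s' =>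
      HasScaled M c s' ∧ s'.var 16 = (n * n + n : ℕ) ∧
      ∀ i < n * n + n + n, s'.arr 5 (i : ℕ) = entry M b hn i := by
  have h := Runs.countLoop (e := var 16) (x := 13) (p := rowStep) (t := 44) hb (by decide)
    (n * n + n)
    (fun i s' => HasScaled M c s' ∧ s'.var 16 = (n * n + n : ℕ) ∧ s'.var 13 = i ∧
      ∀ k < i + n, s'.arr 5 (k : ℕ) = entry M b hn k)
    (fun i s' h => ⟨h.2.2.1, h.2.1⟩)
    (fun i s' hs' ⟨h1, h2, h3, h4⟩ hi =>
      (runs_rowStep hb hs' hn h1 hD hDN hnN hi h3 h4).mono le_rfl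
        fun s'' _ ⟨g1, g2, g3, g4⟩ => ⟨g1, g2.trans h2, g3, g4⟩) hs
    ⟨hin, h16, by simpa using h13, fun k hk => by
      have h := entry_add (M := M) b hn 0 ⟨k, by omega⟩
      rw [zero_mul, zero_add] at h
      rw [h, optimum]
      exact h5 ⟨k, by omega⟩⟩
  refine h.mono (by simp [Term.cost]) ?_
  rintro s' - ⟨h1, h2, -, h4⟩
  exact ⟨h1, h2, h4⟩

/-- Optima never decrease from row to row, so the sum of the increases is positive as soon as one of
them is. The index n² + n in variable `16` is where the last row, row n + 1, begins. -/
theorem runs_flagLoop (hb : Bound w N) (hs : s.Small N) (hn : 0 < n) (h0 : s.var 0 = n)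
    {b : Fin n → ℤ} {D : ℤ} (hD : ∀ v, |b v| ≤ D) (hDN : n * (2 ^ (n + 2) * D) < N)
    (hnN : (n : ℤ) < N) (h13 : s.var 13 = 0) (h15 : s.var 15 = 0)
    (h16 : s.var 16 = (n * n + n : ℕ))
    (h5 : ∀ i < n * n + n + n, s.arr 5 (i : ℕ) = entry M b hn i) :
    Runs w N (loop (sub (var 0) (var 13)) flagStep) s (n * 22 + 4) fun s' =>
      (0 < s'.var 15 ↔ ∃ v, optimum M b n v < optimum M b (n + 1) v) := by
  have hD0 : 0 ≤ D := (abs_nonneg _).trans (hD ⟨0, hn⟩)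
  have h := Runs.countLoop (e := var 0) (x := 13) (p := flagStep) (t := 18) hb (by decide) n
    (fun i s' => s'.var 13 = i ∧ s'.var 0 = n ∧ s'.var 16 = (n * n + n : ℕ) ∧
      s'.arr 5 = s.arr 5 ∧ 0 ≤ s'.var 15 ∧ s'.var 15 ≤ i * (2 ^ (n + 2) * D) ∧
      (0 < s'.var 15 ↔ ∃ v : Fin n, (v : ℕ) < i ∧ optimum M b n v < optimum M b (n + 1) v))
    (fun i s' h => ⟨h.1, h.2.1⟩) ?_ hs
    ⟨by simpa using h13, h0, h16, rfl, h15.ge, by simp [h15], by simp [h15]⟩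
  · refine h.mono (by simp [Term.cost]) ?_
    rintro s' - ⟨-, -, -, -, -, -, h⟩
    rw [h]
    exact ⟨fun ⟨v, _, hv⟩ => ⟨v, hv⟩, fun ⟨v, hv⟩ => ⟨v, v.2, hv⟩⟩
  · rintro i s' hs' ⟨g13, g0, g16, g5, gp, gle, giff⟩ hi
    set v : Fin n := ⟨i, hi⟩ with hv
    have e1 : s'.arr 5 (((n * n + n : ℕ) : ℤ) + i) = optimum M b (n + 1) v := by
      rw [g5, ← entry_add (M := M) b hn (n + 1) v, ← h5 _ (by simp only [hv]; linarith)]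
      congr 1
      push_cast
      ring
    have e2 : s'.arr 5 (((n * n + n : ℕ) : ℤ) + i - n) = optimum M b n v := by
      rw [g5, ← entry_add (M := M) b hn n v, ← h5 _ (by simp only [hv]; linarith)]
      congr 1
      push_cast
      ring
    set x := optimum M b (n + 1) v
    set y := optimum M b n v
    have hxy : y ≤ x := optimum_le_succ M b n v
    have hx : |x| ≤ 2 ^ (n + 1) * D := abs_optimum_le M b hD (n + 1) v
    have hy : |y| ≤ 2 ^ n * D := abs_optimum_le M b hD n v
    have hle : x - y ≤ 2 ^ (n + 2) * D := by
      have h1 := (abs_le.mp hx).2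
      have h2 := (abs_le.mp hy).1
      have h3 : (2 : ℤ) ^ (n + 2) * D = 2 * (2 ^ (n + 1) * D) := by ring
      have h4 : (2 : ℤ) ^ (n + 1) * D = 2 * (2 ^ n * D) := by ring
      have h5 : 0 ≤ 2 ^ n * D := by positivity
      linarith
    have hev : eval s' (add (var 15) (sub (read 5 (add (var 16) (var 13)))
      (read 5 (sub (add (var 16) (var 13)) (var 0))))) = s'.var 15 + (x - y) := by
      simp only [Term.eval, g13, g16, g0, e1, e2]
    have hnew : s'.var 15 + (x - y) ≤ (i + 1 : ℕ) * (2 ^ (n + 2) * D) := by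
      push_cast
      linarith
    have hin : ((i + 1 : ℕ) : ℤ) * (2 ^ (n + 2) * D) ≤ n * (2 ^ (n + 2) * D) :=
      mul_le_mul_of_nonneg_right (by exact_mod_cast hi) (by positivity)
    refine Runs.assign_seq hb hs' (by decide) (by decide) (by
      rw [hev, abs_of_nonneg (by linarith)]
      linarith) fun hs₁ => ?_
    rw [hev] at hs₁ ⊢
    refine Runs.assign hb hs₁ (by decide) (by decide) (by
      simp [Term.eval, g13]
      rw [abs_of_nonneg (by positivity)]
      omega) ⟨by simp [Term.eval, g13], by simp [g0], by simp [g16], by simp [g5], ?_, ?_, ?_⟩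
    · simp
      linarith
    · simpa using hnew
    · simp only [State.setVar_var, reduceIte, Nat.reduceEqDiff]
      constructor
      · intro hpos
        rcases lt_or_ge 0 (s'.var 15) with h | h
        · obtain ⟨v', h1, h2⟩ := giff.mp h
          exact ⟨v', by omega, h2⟩
        · exact ⟨v, Nat.lt_succ_self i, by show y < x; linarith⟩
      · rintro ⟨v', h1, h2⟩
        rcases Nat.lt_succ_iff_lt_or_eq.mp h1 with h1 | h1
        · have := giff.mpr ⟨v', h1, h2⟩
          linarith
        · obtain rfl : v' = v := Fin.ext h1
          have : y < x := h2
          linarith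

/-- Nothing is assumed about array `5`: each entry is written before it is read, so the remains of
earlier tests do no harm. -/
theorem runs_check (hb : Bound w N) (hs : s.Small N) (hn : 0 < n) (hin : HasScaled M c s)
    {a B D : ℤ} (h9 : s.var 9 = B) (h12 : s.var 12 = a)
    (hD : ∀ v, |shift (scaledStart c) a B v| ≤ D) (hDN : n * (2 ^ (n + 2) * D) < N)
    (hnN : (n : ℤ) * n + n < N) :
    Runs w N check s (n * n * 48 + n * 86 + 30) fun s' =>
      (0 < s'.var 15 ↔ ∃ v, optimum M (shift (scaledStart c) a B) n v
        < optimum M (shift (scaledStart c) a B) (n + 1) v) := by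
  have hb2 := hb.two_le
  have hn' : (1 : ℤ) ≤ n := by exact_mod_cast hn
  have hD0 : 0 ≤ D := (abs_nonneg _).trans (hD ⟨0, hn⟩)
  have hp : 0 ≤ 2 ^ (n + 2) * D := by positivity
  have hDN' : 2 ^ (n + 2) * D < N := (le_mul_of_one_le_left hp hn').trans_lt hDN
  have hDN1 : 2 ^ (n + 1) * D < N := by
    have : (2 : ℤ) ^ (n + 2) * D = 2 * (2 ^ (n + 1) * D) := by ring
    have : 0 ≤ 2 ^ (n + 1) * D := by positivity
    linarith
  have hDN2 : D < N := by
    have : 1 * D ≤ 2 ^ (n + 1) * D :=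
      mul_le_mul_of_nonneg_right (one_le_pow₀ (by norm_num)) hD0
    linarith
  have hnN1 : (n : ℤ) < N := by nlinarith
  refine Runs.assign_seq hb hs (by decide) (by simp [Term.cost]) (by simp [Term.eval]; omega)
    fun hs₁ => ?_
  refine Runs.mono (t := (n * 16 + 4) + (8 + ((n * n + n) * 48 + 4 + (n * 22 + 10)))) (R := _) ?_
    (by simp [Term.cost]; ring_nf; omega) fun _ _ h => h
  refine Runs.seq (runs_baseLoop (a := a) (B := B) hb hs₁ (hin.of_eq (by simp) (by simp) (by simp))
    hnN1 (by simp [h9]) (by simp [h12]) (by simp [Term.eval]) fun v => (hD v).trans_lt hDN2) ?_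
  rintro s₂ hs₂ ⟨hin₂, h5⟩
  have hev : eval s₂ (add (mul (var 0) (var 0)) (var 0)) = (n * n + n : ℕ) := by
    simp only [Term.eval, hin₂.size]
    push_cast
    rfl
  refine Runs.assign_seq hb hs₂ (by decide) (by simp [Term.cost]; omega) (by
    rw [hev, Nat.abs_cast]
    exact_mod_cast hnN) fun hs₃ => ?_
  rw [hev] at hs₃ ⊢
  refine Runs.assign_seq hb hs₃ (by decide) (by simp [Term.cost]; omega)
    (by simp [Term.eval]; omega) fun hs₄ => ?_
  refine Runs.mono (t := (n * n + n) * 48 + 4 + (n * 22 + 8)) (R := _) ?_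
    (by simp [Term.cost]; omega) fun _ _ h => h
  refine Runs.seq (runs_rowLoop hb hs₄ hn (hin₂.of_eq (by simp) (by simp) (by simp)) hD hDN1 hnN
    (by simp [Term.eval]) (by simp) (by simpa using h5)) ?_
  rintro s₅ hs₅ ⟨hin₅, h16, h5⟩
  refine Runs.assign_seq hb hs₅ (by decide) (by simp [Term.cost]) (by simp [Term.eval]; omega)
    fun hs₆ => ?_
  refine Runs.assign_seq hb hs₆ (by decide) (by simp [Term.cost]) (by simp [Term.eval]; omega)
    fun hs₇ => ?_
  exact (runs_flagLoop hb hs₇ hn (by simp [hin₅.size]) hD hDN hnN1 (by simp [Term.eval])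
    (by simp [Term.eval]) (by simp [h16]) (by simpa using h5)).mono (by simp [Term.cost])
    fun _ _ h => h

end

end RAM

/-! ### Bisection -/

namespace RAM

open Term Program ReplacementSystem

/-- Bisects the search interval by means of `check` until its length is `1`. -/
def search : Program :=
  loop (sub (var 10) (const 1)) (seq (assign 10 (div (var 10) (const 2)))
    (seq (assign 12 (add (var 11) (var 10)))
      (seq check (branch (var 15) (assign 11 (var 12)) skip))))

/-- The system shifted by `a / B` is unstable. -/
def Unstable {n : ℕ} (M : Fin n → Fin n × Fin n) (c : Fin n → ℚ) (B a : ℤ) : Prop :=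
  ∃ v, optimum M (shift (scaledStart c) a B) n v < optimum M (shift (scaledStart c) a B) (n + 1) v

section

variable {n : ℕ} {M : Fin n → Fin n × Fin n} {c : Fin n → ℚ} {w : ℕ} {N : ℤ} {s s' : State}

/-- The left end stays unstable and the right end stable. The length is a power of two, so halving
is exact and the number of tests is the exponent `J`. -/
theorem runs_search (hb : Bound w N) (hs : s.Small N) (hn : 0 < n) (hin : HasScaled M c s)
    {B D S : ℤ} (h9 : s.var 9 = B) (hD : ∀ a, |a| ≤ S → ∀ v, |shift (scaledStart c) a B v| ≤ D)
    (hDN : n * (2 ^ (n + 2) * D) < N) (hnN : (n : ℤ) * n + n < N) (hSN : S < N) {J : ℕ}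
    (h10 : s.var 10 = 2 ^ J) (hlo : Unstable M c B (s.var 11))
    (hhi : ¬ Unstable M c B (s.var 11 + 2 ^ J)) (hS : -S ≤ s.var 11)
    (hS' : s.var 11 + 2 ^ J ≤ S) :
    Runs w N search s (J * (n * n * 48 + n * 86 + 46) + 4) fun s' =>
      HasScaled M c s' ∧ s'.var 9 = B ∧ |s'.var 11| ≤ S ∧ Unstable M c B (s'.var 11) ∧
        ¬ Unstable M c B (s'.var 11 + 1) := by
  have h := Runs.loop (e := sub (var 10) (const 1)) (t := n * n * 48 + n * 86 + 42)
    (p := seq (assign 10 (div (var 10) (const 2))) (seq (assign 12 (add (var 11) (var 10)))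
      (seq check (branch (var 15) (assign 11 (var 12)) skip)))) hb (by decide)
    (fun k s' => HasScaled M c s' ∧ s'.var 9 = B ∧ s'.var 10 = 2 ^ k ∧
      Unstable M c B (s'.var 11) ∧ ¬ Unstable M c B (s'.var 11 + 2 ^ k) ∧ -S ≤ s'.var 11 ∧
      s'.var 11 + 2 ^ k ≤ S) ?_ J hs ⟨hin, h9, h10, hlo, hhi, hS, hS'⟩
  · refine h.mono (by simp [Term.cost]) ?_
    rintro s' - ⟨⟨k, g1, g2, g3, g4, g5, g6, g7⟩, hle⟩
    simp only [Term.eval, g3] at hle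
    obtain _ | k := k
    · rw [pow_zero] at g5 g7
      exact ⟨g1, g2, abs_le.mpr ⟨g6, by linarith⟩, g4, g5⟩
    · rw [pow_succ] at hle
      have : (1 : ℤ) ≤ 2 ^ k := one_le_pow₀ (by norm_num)
      linarith
  · rintro k s' hs' ⟨g1, g2, g3, g4, g5, g6, g7⟩ hpos
    simp only [Term.eval, g3] at hpos
    obtain _ | k := k
    · simp at hpos
    refine ⟨k, Nat.lt_succ_self k, ?_⟩
    have h2k : (0 : ℤ) < 2 ^ k := by positivity
    have h2k' : (2 : ℤ) ^ (k + 1) = 2 ^ k + 2 ^ k := by ring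
    rw [h2k'] at g5 g7
    set lo := s'.var 11 with hlo'
    have hev : eval s' (div (var 10) (const 2)) = 2 ^ k := by
      simp only [Term.eval, g3]
      omega
    refine Runs.assign_seq hb hs' (by decide) (by simp [Term.cost]) (by
      rw [hev, abs_of_nonneg h2k.le]
      linarith) fun hs₁ => ?_
    rw [hev] at hs₁ ⊢
    have hev' : eval (s'.setVar 10 (2 ^ k)) (add (var 11) (var 10)) = lo + 2 ^ k := by
      simp [Term.eval, hlo']
    have haS : |lo + 2 ^ k| ≤ S := abs_le.mpr ⟨by linarith, by linarith⟩
    refine Runs.assign_seq hb hs₁ (by decide) (by simp [Term.cost]) (by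
      rw [hev']
      exact haS.trans_lt hSN) fun hs₂ => ?_
    rw [hev'] at hs₂ ⊢
    refine Runs.mono (t := (n * n * 48 + n * 86 + 30) + 4) (R := _) ?_
      (by simp [Term.cost]) fun _ _ h => h
    refine Runs.seq (runs_check (a := lo + 2 ^ k) (B := B) (c := c) (M := M) hb hs₂ hn
      (g1.of_eq (by simp) (by simp) (by simp)) (by simp [g2]) (by simp) (hD _ haS) hDN hnN).frame ?_
    rintro s₃ hs₃ ⟨hflag, hv, ha⟩
    change 0 < s₃.var 15 ↔ Unstable M c B (lo + 2 ^ k) at hflag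
    have f0 : s₃.var 0 = s'.var 0 := by rw [hv 0 (by decide)]; simp
    have f3 : s₃.var 3 = s'.var 3 := by rw [hv 3 (by decide)]; simp
    have f9 : s₃.var 9 = B := by rw [hv 9 (by decide)]; simp [g2]
    have f10 : s₃.var 10 = 2 ^ k := by rw [hv 10 (by decide)]; simp
    have f11 : s₃.var 11 = lo := by rw [hv 11 (by decide)]; simp [hlo']
    have f12 : s₃.var 12 = lo + 2 ^ k := by rw [hv 12 (by decide)]; simp
    have fa : ∀ a < 5, s₃.arr a = s'.arr a := fun a h => by
      rw [ha a (by simp [check, baseStep, rowStep, flagStep, arrs]; omega)]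
      rfl
    refine Runs.mono (t := (var 15).cost + 1 + 2) (R := _) ?_ (by decide) fun _ _ h => h
    refine Runs.branch hb hs₃ (by decide) (fun hpos => ?_) fun hneg => ?_
    · refine Runs.assign hb hs₃ (by decide) (by decide) (hs₃.var _)
        ⟨g1.of_eq (by simp [f0]) (by simp [f3]) (by simpa using fa), by simp [f9], by simp [f10],
          ?_, ?_, ?_, ?_⟩
      · simpa [Term.eval, f12] using hflag.mp hpos
      · simpa [Term.eval, f12, add_assoc] using g5
      · simp [Term.eval, f12]
        linarith
      · simp [Term.eval, f12]
        linarith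
    · refine Runs.skip hs₃ ⟨g1.of_eq f0 f3 fa, f9, f10, ?_, ?_, ?_, ?_⟩ (by norm_num)
      · rwa [f11]
      · rw [f11]
        exact fun h => absurd (hflag.mpr h) (not_lt.mpr hneg)
      · rwa [f11]
      · rw [f11]
        linarith

end

/-! ### Continued fraction convergents -/

/-- The state of Euclid's algorithm on `(B, A)`: the remainders `r₀, r₁`, and the denominators
`q₀, q₁` of the approximations of `A / B`. -/
structure IsApprox (A B r₀ r₁ q₀ q₁ : ℤ) : Prop where
  nonneg : 0 ≤ r₁
  le : r₁ ≤ r₀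
  pos : 0 < r₀
  coprime : IsCoprime r₀ r₁
  den_nonneg : 0 ≤ q₀
  den_pos : 1 ≤ q₁
  den_le : q₀ ≤ q₁
  det : q₁ * r₀ + q₀ * r₁ = B
  dvd : ∃ σ : ℤ, (σ = 1 ∨ σ = -1) ∧ B ∣ q₀ * A + σ * r₀ ∧ B ∣ q₁ * A - σ * r₁

namespace IsApprox

variable {A B r₀ r₁ q₀ q₁ : ℤ}

theorem init (hB : 0 < B) (hAB : IsCoprime B A) : IsApprox A B B (A - A / B * B) 0 1 := by
  have hmod : A - A / B * B = A % B := by rw [Int.emod_def, mul_comm]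
  refine ⟨?_, ?_, hB, ?_, le_rfl, le_rfl, by norm_num, by ring, 1, Or.inl rfl, by simp, ?_⟩
  · rw [hmod]
    exact Int.emod_nonneg _ hB.ne'
  · rw [hmod]
    exact (Int.emod_lt_of_pos _ hB).le
  · obtain ⟨a, b, h⟩ := hAB
    exact ⟨a + b * (A / B), b, by linear_combination h⟩
  · exact ⟨A / B, by ring⟩

theorem mul_le (h : IsApprox A B r₀ r₁ q₀ q₁) : q₁ * r₀ ≤ B := by
  have := mul_nonneg h.den_nonneg h.nonneg
  linarith [h.det]

/-- If `r₁` vanished, coprimality would force `r₀ = 1` and the determinant `q₁ = B`. So Euclid's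
algorithm cannot run out before the denominators are large enough. -/
theorem pos_of_lt (h : IsApprox A B r₀ r₁ q₀ q₁) (hq : q₁ < B) : 0 < r₁ := by
  refine lt_of_le_of_ne h.nonneg fun h0 => ?_
  have h1 := h.coprime
  rw [← h0, isCoprime_zero_right, Int.isUnit_iff] at h1
  have h2 := h.det
  have h3 := h.pos
  rcases h1 with h1 | h1
  · rw [← h0, h1] at h2
    linarith
  · omega

/-- Both congruences are linear in the pair of denominator and remainder, with opposite signs of the
remainder; hence `σ` changes its sign in each step. -/
theorem step (h : IsApprox A B r₀ r₁ q₀ q₁) (hr : 0 < r₁) :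
    IsApprox A B r₁ (r₀ - r₀ / r₁ * r₁) q₁ (q₀ + r₀ / r₁ * q₁) := by
  have hmod : r₀ - r₀ / r₁ * r₁ = r₀ % r₁ := by rw [Int.emod_def, mul_comm]
  have ht : 1 ≤ r₀ / r₁ := (Int.le_ediv_iff_mul_le hr).mpr (by linarith [h.le])
  have hq : q₁ ≤ r₀ / r₁ * q₁ := le_mul_of_one_le_left (by linarith [h.den_pos]) ht
  have h1 := h.den_pos
  have h2 := h.den_nonneg
  refine ⟨?_, ?_, hr, ?_, by linarith, by linarith, by linarith, ?_, ?_⟩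
  · rw [hmod]
    exact Int.emod_nonneg _ hr.ne'
  · rw [hmod]
    exact (Int.emod_lt_of_pos _ hr).le
  · obtain ⟨a, b, h⟩ := h.coprime
    exact ⟨b + a * (r₀ / r₁), a, by linear_combination h⟩
  · linear_combination h.det
  · obtain ⟨σ, hσ, d1, d2⟩ := h.dvd
    refine ⟨-σ, by omega, ?_, ?_⟩
    · simpa [sub_eq_add_neg] using d2
    · obtain ⟨x, hx⟩ := d1
      obtain ⟨y, hy⟩ := d2
      exact ⟨x + r₀ / r₁ * y, by linear_combination hx + r₀ / r₁ * hy⟩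

/-- If `A / B` is close to a fraction `W / T` with a small denominator, then the approximation with
the denominator `q₀` is equal to this fraction. -/
theorem round_mul_eq (h : IsApprox A B r₀ r₁ q₀ q₁) {p W T : ℤ} (hp : 1 ≤ p)
    (hB : B = 32 * p ^ 2) (hq0 : q₀ ≤ 4 * p) (hq1 : 4 * p < q₁) (hT : 0 < T) (hTp : T ≤ 2 * p)
    (hWT : |T * A - W * B| ≤ T) :
    (2 * (q₀ * A) + B) / (2 * B) * T = W * q₀ := by
  obtain ⟨σ, hσ, ⟨P, hP⟩, -⟩ := h.dvd
  have hqr := h.mul_le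
  have hr := h.pos
  have hB0 : 0 < B := by rw [hB]; positivity
  have h4 : 4 * p * r₀ < B := (mul_lt_mul_of_pos_right hq1 hr).trans_le hqr
  have hσr : |σ * r₀| = r₀ := by
    rcases hσ with rfl | rfl
    · rw [one_mul, abs_of_pos hr]
    · rw [neg_one_mul, abs_neg, abs_of_pos hr]
  -- The distance of q₀ A / B from the integer P is r₀ / B < 1/4, so rounding to the nearest integer
  -- finds P.
  have hround : (2 * (q₀ * A) + B) / (2 * B) = P := by
    have h5 : 4 * r₀ ≤ 4 * p * r₀ := by nlinarith
    have h6 := abs_le.mp hσr.le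
    rw [Int.ediv_eq_iff_of_pos (by linarith)]
    constructor <;> nlinarith
  rw [hround]
  -- The first summand is less than B/2 in magnitude because T ≤ 2p and 4 p r₀ < B, the second is at
  -- most q₀ T ≤ 8p² = B/4. So the integer P T - W q₀ is zero.
  have h7 : (P * T - W * q₀) * B = T * (σ * r₀) + q₀ * (T * A - W * B) := by
    linear_combination (-T) * hP
  have h8 : |(P * T - W * q₀) * B| ≤ T * r₀ + q₀ * T := by
    rw [h7]
    refine (abs_add_le _ _).trans ?_
    rw [abs_mul T, abs_mul q₀, hσr, abs_of_pos hT, abs_of_nonneg h.den_nonneg]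
    have := mul_le_mul_of_nonneg_left hWT h.den_nonneg
    linarith
  have h9 : T * r₀ ≤ 2 * p * r₀ := mul_le_mul_of_nonneg_right hTp hr.le
  have h10 : q₀ * T ≤ 4 * p * (2 * p) := mul_le_mul hq0 hTp hT.le (by linarith)
  have h11 : |P * T - W * q₀| * B < 1 * B := by
    rw [abs_mul, abs_of_pos hB0] at h8
    nlinarith
  have h12 := lt_of_mul_lt_mul_right h11 hB0.le
  rw [Int.abs_lt_one_iff] at h12
  linarith

end IsApprox

end RAM

/-! ### Recovering the exact fraction -/

namespace RAM

open Term Program ReplacementSystem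

/-- One division of Euclid's algorithm, with the denominators of the approximations. -/
def approxStep : Program :=
  seq (assign 6 (div (var 18) (var 19))) (seq (assign 22 (sub (var 18) (mul (var 6) (var 19))))
    (seq (assign 18 (var 19)) (seq (assign 19 (var 22))
      (seq (assign 22 (add (var 20) (mul (var 6) (var 21))))
        (seq (assign 20 (var 21)) (assign 21 (var 22)))))))

/-- Finds the denominator of an approximation of the midpoint of the search interval in
variable `20`. -/
def approx : Program :=
  seq (assign 16 (add (add (var 11) (var 11)) (const 1)))
    (seq (assign 17 (add (var 9) (var 9))) (seq (assign 18 (var 17))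
      (seq (assign 19 (sub (var 16) (mul (div (var 16) (var 17)) (var 17))))
        (seq (assign 20 (const 0)) (seq (assign 21 (const 1))
          (loop (sub (add (mul (const 4) (var 8)) (const 1)) (var 21)) approxStep))))))

/-- Rounds to the numerator of the approximation, divides by the common denominator and reduces the
fraction to lowest terms. -/
def reduce : Program :=
  seq (assign 23 (div (add (mul (const 2) (mul (var 20) (var 16))) (var 17))
      (mul (const 2) (var 17))))
    (seq (assign 24 (mul (var 20) (var 3))) (seq (assign 4 (var 23)) (seq (assign 5 (var 24))
      (seq euclid (seq (assign 0 (div (var 23) (var 4))) (assign 1 (div (var 24) (var 4))))))))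

section

variable {w : ℕ} {N : ℤ} {s : State}

theorem runs_approxStep (hb : Bound w N) (hs : s.Small N) {A B : ℤ}
    (h : IsApprox A B (s.var 18) (s.var 19) (s.var 20) (s.var 21)) (hr : 0 < s.var 19)
    (hBN : B < N) :
    Runs w N approxStep s 24 fun s' =>
      IsApprox A B (s'.var 18) (s'.var 19) (s'.var 20) (s'.var 21) ∧ s'.var 20 = s.var 21 ∧
        s.var 20 + s.var 21 ≤ s'.var 21 := by
  have h' := h.step hr
  set r₀ := s.var 18 with hr0
  set r₁ := s.var 19 with hr1
  set q₀ := s.var 20 with hq0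
  set q₁ := s.var 21 with hq1
  have ht : 1 ≤ r₀ / r₁ := (Int.le_ediv_iff_mul_le hr).mpr (by linarith [h.le])
  have hN0 : r₀ < N := by nlinarith [h.mul_le, h.den_pos, h.pos]
  have hq1N : q₀ + r₀ / r₁ * q₁ < N := by nlinarith [h'.mul_le, h'.den_pos]
  refine Runs.assign_seq hb hs (by decide) (by decide) ?_ fun hs₁ => ?_
  · exact (abs_ediv_le_abs _ _).trans_lt (hs.var 18)
  refine Runs.assign_seq hb hs₁ (by decide) (by decide) ?_ fun hs₂ => ?_
  · simp only [Term.eval, State.setVar_var, reduceIte, Nat.reduceEqDiff, ← hr0, ← hr1]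
    rw [abs_of_nonneg h'.nonneg]
    linarith [h'.le, h.le]
  refine Runs.assign_seq hb hs₂ (by decide) (by decide) (hs₂.var _) fun hs₃ => ?_
  refine Runs.assign_seq hb hs₃ (by decide) (by decide) (hs₃.var _) fun hs₄ => ?_
  refine Runs.assign_seq hb hs₄ (by decide) (by decide) ?_ fun hs₅ => ?_
  · simp only [Term.eval, State.setVar_var, reduceIte, Nat.reduceEqDiff, ← hr0, ← hr1, ← hq0,
      ← hq1]
    rw [abs_of_nonneg (by linarith [h'.den_pos])]
    exact hq1N
  refine Runs.assign_seq hb hs₅ (by decide) (by decide) (hs₅.var _) fun hs₆ => ?_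
  refine Runs.assign hb hs₆ (by decide) (by decide) (hs₆.var _) ?_
  simp only [Term.eval, State.setVar_var, reduceIte, Nat.reduceEqDiff, ← hr0, ← hr1, ← hq0,
    ← hq1]
  refine ⟨h', trivial, ?_⟩
  nlinarith [h.den_pos]

theorem runs_approx (hb : Bound w N) (hs : s.Small N) {n : ℕ} {lo : ℤ} (h8 : s.var 8 = 2 ^ n)
    (h9 : s.var 9 = 2 ^ (2 * n + 4)) (h11 : s.var 11 = lo) (hloN : 2 * |lo| + 1 < N)
    (hBN : 2 ^ (2 * n + 5) < N) :
    Runs w N approx s ((2 * n + 6) * 32 + 40) fun s' =>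
      s'.var 16 = 2 * lo + 1 ∧ s'.var 17 = 2 ^ (2 * n + 5) ∧
      IsApprox (2 * lo + 1) (2 ^ (2 * n + 5)) (s'.var 18) (s'.var 19) (s'.var 20) (s'.var 21) ∧
      1 ≤ s'.var 20 ∧ s'.var 20 ≤ 4 * 2 ^ n ∧ 4 * 2 ^ n < s'.var 21 := by
  have hb2 := hb.two_le
  set A := 2 * lo + 1 with hA
  set B : ℤ := 2 ^ (2 * n + 5) with hB
  have hB0 : 0 < B := by positivity
  -- The midpoint has an odd numerator over a power of two.
  have hAB : IsCoprime B A := IsCoprime.pow_left ⟨-lo, 1, by rw [hA]; ring⟩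
  have hinit := IsApprox.init hB0 hAB
  have e1 : eval s (add (add (var 11) (var 11)) (const 1)) = A := by
    simp only [Term.eval, h11, hA]
    ring
  refine Runs.assign_seq hb hs (by decide) (by simp [Term.cost]) ?_ fun hs₁ => ?_
  · rw [e1, hA]
    refine (abs_add_le _ _).trans_lt ?_
    rwa [abs_mul, abs_two, abs_one]
  rw [e1] at hs₁ ⊢
  have e2 : eval (s.setVar 16 A) (add (var 9) (var 9)) = B := by
    simp only [Term.eval, State.setVar_var, reduceIte, Nat.reduceEqDiff, h9, hB]
    ring
  refine Runs.assign_seq hb hs₁ (by decide) (by simp [Term.cost])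
    (by rwa [e2, abs_of_pos hB0]) fun hs₂ => ?_
  rw [e2] at hs₂ ⊢
  refine Runs.assign_seq hb hs₂ (by decide) (by simp [Term.cost]) (hs₂.var _) fun hs₃ => ?_
  refine Runs.assign_seq hb hs₃ (by decide) (by simp [Term.cost]) ?_ fun hs₄ => ?_
  · simp only [Term.eval, State.setVar_var, reduceIte, Nat.reduceEqDiff]
    rw [abs_of_nonneg hinit.nonneg]
    linarith [hinit.le]
  refine Runs.assign_seq hb hs₄ (by decide) (by simp [Term.cost])
    (by simp [Term.eval]; omega) fun hs₅ => ?_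
  refine Runs.assign_seq hb hs₅ (by decide) (by simp [Term.cost])
    (by simp [Term.eval]; omega) fun hs₆ => ?_
  have hp : (0 : ℤ) < 2 ^ n := by positivity
  have hBp : B = 32 * (2 ^ n) ^ 2 := by rw [hB]; ring
  have h := Runs.loop (e := sub (add (mul (const 4) (var 8)) (const 1)) (var 21)) (t := 24)
    (p := approxStep) hb (by decide)
    (fun k s' => s'.var 8 = 2 ^ n ∧ s'.var 16 = A ∧ s'.var 17 = B ∧
      IsApprox A B (s'.var 18) (s'.var 19) (s'.var 20) (s'.var 21) ∧ s'.var 20 ≤ 4 * 2 ^ n ∧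
      -- The product q₀ q₁ at least doubles per division, as the new q₁ is at least q₀ + q₁ ≥ 2 q₀.
      -- While the loop continues, it is at most 16 · 4^n < B, which bounds the rounds. The initial
      -- q₀ = 0 makes the product zero and is treated apart.
      ((s'.var 20 = 0 ∧ s'.var 21 = 1 ∧ k = 2 * n + 6) ∨
        (1 ≤ s'.var 20 ∧ B ≤ s'.var 20 * s'.var 21 * 2 ^ k))) ?_ (2 * n + 6) hs₆ ?_
  · refine h.mono (by simp [Term.cost]) ?_
    rintro s' - ⟨⟨k, g1, g2, g3, g4, g5, g6⟩, hle⟩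
    simp only [Term.eval, g1] at hle
    refine ⟨g2, g3, g4, ?_, g5, by linarith⟩
    rcases g6 with ⟨-, k2, -⟩ | ⟨k1, -⟩
    · linarith
    · exact k1
  · rintro k s' hs' ⟨g1, g2, g3, g4, g5, g6⟩ hpos
    simp only [Term.eval, g1] at hpos
    have hq : s'.var 21 ≤ 4 * 2 ^ n := by linarith
    have hr : 0 < s'.var 19 := g4.pos_of_lt (by nlinarith)
    obtain ⟨j, hj, hjB⟩ : ∃ j < k, ∀ q, s'.var 20 + s'.var 21 ≤ q → B ≤ s'.var 21 * q * 2 ^ j := by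
      rcases g6 with ⟨k1, k2, rfl⟩ | ⟨k1, k2⟩
      · refine ⟨2 * n + 5, by omega, fun q hq => ?_⟩
        rw [k1, k2] at hq
        rw [k2]
        nlinarith
      · obtain _ | k := k
        · exfalso
          rw [pow_zero, mul_one] at k2
          have : s'.var 20 * s'.var 21 ≤ 4 * 2 ^ n * (4 * 2 ^ n) :=
            mul_le_mul g5 hq (by linarith [g4.den_pos]) (by linarith)
          nlinarith
        · refine ⟨k, Nat.lt_succ_self k, fun q hq => k2.trans ?_⟩
          have h1 : s'.var 20 * 2 ≤ q := by linarith [g4.den_le]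
          have h2 : s'.var 21 * (s'.var 20 * 2) ≤ s'.var 21 * q :=
            mul_le_mul_of_nonneg_left h1 (by linarith [g4.den_pos])
          have h3 := mul_le_mul_of_nonneg_right h2 (show (0 : ℤ) ≤ 2 ^ k by positivity)
          rw [pow_succ]
          linarith
    refine ⟨j, hj, (runs_approxStep hb hs' g4 hr hBN).frame.mono le_rfl ?_⟩
    rintro s'' - ⟨⟨f1, f2, f3⟩, hv, -⟩
    refine ⟨by rw [hv 8 (by decide), g1], by rw [hv 16 (by decide), g2],
      by rw [hv 17 (by decide), g3], f1, by rwa [f2], Or.inr ⟨by rw [f2]; exact g4.den_pos, ?_⟩⟩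
    rw [f2]
    exact hjB _ f3
  · simp only [Term.eval, State.setVar_var, reduceIte, Nat.reduceEqDiff]
    exact ⟨h8, trivial, trivial, hinit, by linarith, Or.inl ⟨trivial, trivial, trivial⟩⟩

/-- Division by d can create common factors with P, hence one more gcd. P may be zero or negative;
Euclid's algorithm only needs q d > 0. -/
theorem runs_reduce (hb : Bound w N) (hs : s.Small N) {d : ℕ} (hd : 0 < d) (h3 : s.var 3 = d)
    {A B q P : ℤ} (h16 : s.var 16 = A) (h17 : s.var 17 = B) (h20 : s.var 20 = q) (hq : 0 < q)
    (hP : (2 * (q * A) + B) / (2 * B) = P) (hAN : |2 * (q * A) + B| < N) {l : ℕ}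
    (hl : q * d < 2 ^ l) (hlN : 2 ^ l ≤ N) :
    Runs w N reduce s (28 * l + 50) fun s' =>
      s'.var 0 = ((P / (q * d) : ℚ)).num ∧ s'.var 1 = ((P / (q * d) : ℚ)).den := by
  have hqd : 0 < q * d := mul_pos hq (by exact_mod_cast hd)
  have e1 : eval s (div (add (mul (const 2) (mul (var 20) (var 16))) (var 17))
      (mul (const 2) (var 17))) = P := by
    simp only [Term.eval, h16, h17, h20, hP]
  refine Runs.assign_seq hb hs (by decide) (by simp [Term.cost]) ?_ fun hs₁ => ?_
  · rw [e1, ← hP]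
    exact (abs_ediv_le_abs _ _).trans_lt hAN
  rw [e1] at hs₁ ⊢
  have e2 : eval (s.setVar 23 P) (mul (var 20) (var 3)) = q * d := by
    simp only [Term.eval, State.setVar_var, reduceIte, Nat.reduceEqDiff, h20, h3]
  refine Runs.assign_seq hb hs₁ (by decide) (by simp [Term.cost])
    (by rw [e2, abs_of_pos hqd]; linarith) fun hs₂ => ?_
  rw [e2] at hs₂ ⊢
  refine Runs.assign_seq hb hs₂ (by decide) (by simp [Term.cost]) (hs₂.var _) fun hs₃ => ?_
  refine Runs.assign_seq hb hs₃ (by decide) (by simp [Term.cost]) (hs₃.var _) fun hs₄ => ?_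
  simp only [Term.eval, State.setVar_var, reduceIte, Nat.reduceEqDiff] at hs₄ ⊢
  refine Runs.mono (t := 14 * (2 * l + 1) + 2 + 8) (R := _) ?_ (by simp [Term.cost]; omega)
    fun _ _ h => h
  refine Runs.seq (runs_euclid (l := l) hb hs₄ (by simpa using hqd) (by simpa using hl)).frame ?_
  rintro s₅ hs₅ ⟨hg, hv, -⟩
  have f23 : s₅.var 23 = P := by rw [hv 23 (by decide)]; simp
  have f24 : s₅.var 24 = q * d := by rw [hv 24 (by decide)]; simp
  simp only [State.setVar_var, reduceIte, Nat.reduceEqDiff] at hg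
  refine Runs.assign_seq hb hs₅ (by decide) (by decide)
    ((abs_ediv_le_abs _ _).trans_lt (hs₅.var 23)) fun hs₆ => ?_
  refine Runs.assign hb hs₆ (by decide) (by decide)
    ((abs_ediv_le_abs _ _).trans_lt (hs₆.var 24)) ?_
  have hr : (P / (q * d) : ℚ) = Rat.divInt P (q * d) := by
    rw [Rat.divInt_eq_div]
    push_cast
    rfl
  simp only [Term.eval, State.setVar_var, reduceIte, Nat.reduceEqDiff, f23, f24, hg]
  rw [hr, Rat.num_divInt, Rat.den_divInt, if_neg hqd.ne', Int.sign_eq_one_of_pos hqd, one_mul,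
    Int.gcd_comm]
  refine ⟨rfl, ?_⟩
  push_cast
  rw [abs_of_pos hqd]

end

end RAM

/-! ### Assembly and explicit constants -/

namespace RAM

open Term Program ReplacementSystem

/-- The program that computes the growth rate. -/
def growthRateProgram : Program :=
  seq lcmLoop (seq scaleLoop (seq bracket (seq search (seq approx reduce))))

section

variable {n : ℕ} {M : Fin n → Fin n × Fin n} {c : Fin n → ℚ}

/-- The strict bound `m` leaves a slack of 1 in the bound for `W`, which makes the left end of the
initial interval strictly smaller than the ratio sought. -/
theorem exists_ratSystem_growthRate [NeZero n] {m : ℤ} (hm : ∀ v, |scaledStart c v| < m) :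
    ∃ (W : ℤ) (T : ℕ), 1 ≤ T ∧ T ≤ 2 ^ (n + 1) ∧ |W| ≤ (m - 1) * T ∧
      (ratSystem M c).IsGrowthRate (W / (T * commonDen c)) ∧ ∀ a B : ℤ, 0 < B →
        (Unstable M c B a ↔ a * T < B * W) := by
  obtain ⟨W, T, h1, h2, h3, h4, h5⟩ := exists_growthRate (ratSystem M c) (scaledStart c)
    (commonDen c) (by exact_mod_cast commonDen_pos c)
    (fun v => by
      have h := congrArg (Rat.cast (K := ℝ)) (commonDen_mul c v)
      push_cast at h
      exact h)
    (M := m - 1) (fun v => by have := hm v; omega)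
  rw [Fintype.card_fin] at h2 h5
  refine ⟨W, T, h1, h2, h3, h4, fun a B hB => ?_⟩
  have h := (h5 a B hB).not
  push Not at h
  exact h

theorem size_pos_commonDen (c : Fin n → ℚ) : 0 < Nat.size (commonDen c) :=
  Nat.size_pos.mpr (commonDen_pos c)

theorem commonDen_lt (c : Fin n → ℚ) : commonDen c < 2 ^ bitLength c :=
  (Nat.lt_size_self _).trans_le (Nat.pow_le_pow_right (by norm_num) (Nat.le_add_right _ _))

theorem abs_scaledStart_lt (c : Fin n → ℚ) (v : Fin n) : |scaledStart c v| < 2 ^ bitLength c := by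
  have h : (scaledStart c v).natAbs < 2 ^ bitLength c :=
    (natAbs_scaledStart_le c v).trans_lt ((Nat.lt_size_self _).trans_le
      (Nat.pow_le_pow_right (by norm_num) (Nat.le_add_left _ _)))
  rw [Int.abs_eq_natAbs]
  exact_mod_cast h

/-- Scaling multiplies a numerator by a positive integer, so the length measured on scaled values
also covers the raw input. -/
theorem abs_num_lt (c : Fin n → ℚ) (v : Fin n) : |(c v).num| < 2 ^ bitLength c := by
  refine lt_of_le_of_lt ?_ (abs_scaledStart_lt c v)
  rw [scaledStart, abs_mul, Nat.abs_cast]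
  refine le_mul_of_one_le_right (abs_nonneg _) ?_
  exact_mod_cast Nat.div_pos (Nat.le_of_dvd (commonDen_pos c) (den_dvd_commonDen c v))
    (c v).den_pos

theorem small_inputState {N : ℤ} (hn : (n : ℤ) < N) (hN : 2 ^ bitLength c ≤ N) :
    (inputState M c).Small N where
  var x := by
    simp only [inputState]
    split_ifs
    · rwa [Nat.abs_cast]
    · rw [abs_zero]
      omega
  arr a i := by
    have hden : ∀ v, ((c v).den : ℤ) < N := fun v => by
      refine lt_of_lt_of_le ?_ hN
      exact_mod_cast (Nat.le_of_dvd (commonDen_pos c) (den_dvd_commonDen c v)).trans_lt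
        (commonDen_lt c)
    have hfin : ∀ v : Fin n, ((v : ℕ) : ℤ) < N := fun v => by have := v.2; omega
    simp only [inputState]
    split_ifs
    · rw [Nat.abs_cast]
      exact hfin _
    · rw [Nat.abs_cast]
      exact hfin _
    · exact (abs_num_lt c _).trans_le hN
    · rw [Nat.abs_cast]
      exact hden _
    · rw [abs_zero]
      omega
    · rw [abs_zero]
      omega

theorem runs_approx_reduce [NeZero n] {w : ℕ} {N : ℤ} {s : State} (hb : Bound w N) (hs : s.Small N) {l : ℕ}
    (h3 : s.var 3 = commonDen c) (h8 : s.var 8 = 2 ^ n) (h9 : s.var 9 = 2 ^ (2 * n + 4)) {lo : ℤ}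
    (h11 : s.var 11 = lo) (hl : commonDen c < 2 ^ l) {j : ℕ} (hlo : |lo| ≤ 2 ^ j)
    (hNj : 2 ^ (n + j + 7) ≤ N) (hNn : 2 ^ (2 * n + 6) ≤ N) (hNl : 2 ^ (n + l + 2) ≤ N) {W : ℤ}
    {T : ℕ} (hT : 1 ≤ T) (hT2 : T ≤ 2 ^ (n + 1))
    (hr : (ratSystem M c).IsGrowthRate (W / (T * commonDen c)))
    (hW : lo * T < 2 ^ (2 * n + 4) * W) (hW' : 2 ^ (2 * n + 4) * W ≤ (lo + 1) * T) :
    Runs w N (seq approx reduce) s (((2 * n + 6) * 32 + 40) + (28 * (n + l + 2) + 50)) fun s' =>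
      ∃ r : ℚ, (ratSystem M c).IsGrowthRate (r : ℝ) ∧ s'.var 0 = r.num ∧ s'.var 1 = r.den := by
  have hp : (1 : ℤ) ≤ 2 ^ n := one_le_pow₀ (by norm_num)
  have hj1 : (1 : ℤ) ≤ 2 ^ j := one_le_pow₀ (by norm_num)
  have hnj : (2 : ℤ) ^ (n + j + 7) = 128 * (2 ^ n * 2 ^ j) := by ring
  have h2n : (2 : ℤ) ^ (2 * n + 5) = 32 * (2 ^ n) ^ 2 := by ring
  have h2n4 : (2 : ℤ) ^ (2 * n + 5) = 2 * 2 ^ (2 * n + 4) := by ring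
  have h2n6 : (2 : ℤ) ^ (2 * n + 6) = 2 * 2 ^ (2 * n + 5) := by ring
  have hB0 : (0 : ℤ) < 2 ^ (2 * n + 5) := by positivity
  have hjj : (2 : ℤ) ^ j ≤ 2 ^ n * 2 ^ j := le_mul_of_one_le_left (by positivity) hp
  refine Runs.seq (runs_approx hb hs h8 h9 h11 (by linarith) (by linarith)).frame ?_
  rintro s₁ hs₁ ⟨⟨h16, h17, happ, hq1, hq2, hq3⟩, hv, -⟩
  have hTz : (1 : ℤ) ≤ T := by exact_mod_cast hT
  have hT2z : (T : ℤ) ≤ 2 * 2 ^ n := by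
    rw [← pow_succ']
    exact_mod_cast hT2
  -- W/T lies in the final interval, so it differs from the midpoint by at most half of its length,
  -- 1 / 2^(2n+5).
  have key := happ.round_mul_eq (p := 2 ^ n) (W := W) (T := T) hp h2n hq2 hq3 (by linarith) hT2z
    (by rw [h2n4]; exact abs_le.mpr ⟨by linarith, by linarith⟩)
  set q := s₁.var 20 with hq
  set P := (2 * (q * (2 * lo + 1)) + 2 ^ (2 * n + 5)) / (2 * 2 ^ (2 * n + 5)) with hP
  have hdl : ((commonDen c : ℕ) : ℤ) < 2 ^ l := by exact_mod_cast hl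
  have hqd : q * commonDen c < 2 ^ (n + l + 2) := by
    have h1 : q * commonDen c ≤ 4 * 2 ^ n * commonDen c :=
      mul_le_mul_of_nonneg_right hq2 (by positivity)
    have h2 : 4 * 2 ^ n * (commonDen c : ℤ) < 4 * 2 ^ n * 2 ^ l :=
      mul_lt_mul_of_pos_left hdl (by positivity)
    have h3 : (2 : ℤ) ^ (n + l + 2) = 4 * 2 ^ n * 2 ^ l := by ring
    linarith
  have hlt : |2 * (q * (2 * lo + 1)) + 2 ^ (2 * n + 5)| < N := by
    have h1 : |2 * lo + 1| ≤ 3 * 2 ^ j := by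
      have := abs_le.mp hlo
      exact abs_le.mpr ⟨by linarith, by linarith⟩
    have h2 : |q * (2 * lo + 1)| ≤ 4 * 2 ^ n * (3 * 2 ^ j) := by
      rw [abs_mul, abs_of_pos (by linarith : 0 < q)]
      exact mul_le_mul hq2 h1 (abs_nonneg _) (by positivity)
    have h3 := abs_le.mp h2
    have h4 : 2 * (q * (2 * lo + 1)) + 2 ^ (2 * n + 5) < N := by linarith
    have h5 : -N < 2 * (q * (2 * lo + 1)) + 2 ^ (2 * n + 5) := by linarith
    exact abs_lt.mpr ⟨h5, h4⟩
  refine (runs_reduce hb hs₁ (commonDen_pos c) (by rw [hv 3 (by decide), h3]) h16 h17 rfl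
    (by linarith) hP.symm hlt hqd hNl).mono le_rfl ?_
  rintro s₂ - ⟨g0, g1⟩
  refine ⟨_, ?_, g0, g1⟩
  convert hr using 1
  have hqr : (q : ℝ) ≠ 0 := by exact_mod_cast (by linarith : 0 < q).ne'
  have hTr : (T : ℝ) ≠ 0 := by exact_mod_cast (by omega : T ≠ 0)
  have hdr : (commonDen c : ℝ) ≠ 0 := by exact_mod_cast (commonDen_pos c).ne'
  have hkey : (P : ℝ) * T = W * q := by exact_mod_cast key
  push_cast
  rw [div_eq_div_iff (by positivity) (by positivity)]
  linear_combination (commonDen c : ℝ) * hkey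

/-- With L = n + ℓ, stored numbers stay below 2^(16 L), and 256 = 16 · 16 allows for expressions of
weight 16. The time is dominated by O(L) stability tests of O(n²) steps each. -/
theorem runs_growthRateProgram [NeZero n] {w : ℕ} (hw : 256 * (n + bitLength c) ≤ w) :
    Runs w (2 ^ (16 * (n + bitLength c))) growthRateProgram (inputState M c)
      (2500 * n ^ 2 * (n + bitLength c)) fun s' =>
        ∃ r : ℚ, (ratSystem M c).IsGrowthRate (r : ℝ) ∧ s'.var 0 = r.num ∧ s'.var 1 = r.den := by
  have hn : 0 < n := Nat.pos_of_ne_zero (NeZero.ne n)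
  set l := bitLength c with hl
  have hl1 : 1 ≤ l := (size_pos_commonDen c).trans_le (Nat.le_add_right _ _)
  set L := n + l with hL
  set N : ℤ := 2 ^ (16 * L) with hN
  have hpow : ∀ k ≤ 16 * L, (2 : ℤ) ^ k ≤ N := fun k hk => pow_le_pow_right₀ (by norm_num) hk
  have hpow' : ∀ k < 16 * L, (2 : ℤ) ^ k < N := fun k hk => pow_lt_pow_right₀ (by norm_num) hk
  have hb : Bound w N := by
    refine ⟨?_, ?_⟩
    · simpa using hpow 1 (by omega)
    · rw [hN, ← pow_mul]
      exact pow_le_pow_right₀ (by norm_num) (by omega)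
  have hn2 : ((n : ℤ) + 1) ≤ 2 ^ n := by exact_mod_cast Nat.lt_two_pow_self (n := n)
  have hnn : (n : ℤ) * n + n ≤ 2 ^ (2 * n) := by
    have : (2 : ℤ) ^ (2 * n) = 2 ^ n * 2 ^ n := by ring
    nlinarith
  have hnn' : (n : ℤ) * n + n < N := hnn.trans_lt (hpow' _ (by omega))
  have hnN : (n : ℤ) + 1 < N := hn2.trans_lt (hpow' _ (by omega))
  have hSL : 1 + (n : ℤ) * (2 ^ l) ^ 2 ≤ 2 ^ (2 * L) := by
    have h1 : (1 : ℤ) ≤ (2 ^ l) ^ 2 := one_le_pow₀ (one_le_pow₀ (by norm_num))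
    have h2 : ((n : ℤ) + 1) * (2 ^ l) ^ 2 ≤ 2 ^ n * (2 ^ l) ^ 2 :=
      mul_le_mul_of_nonneg_right hn2 (by positivity)
    have h3 : (2 : ℤ) ^ n * (2 ^ l) ^ 2 = 2 ^ (n + 2 * l) := by ring
    have h4 : (2 : ℤ) ^ (n + 2 * l) ≤ 2 ^ (2 * L) := pow_le_pow_right₀ (by norm_num) (by omega)
    linarith
  have hstart : ∀ v, |scaledStart c v| ≤ 2 ^ l := fun v => (abs_scaledStart_lt c v).le
  refine Runs.mono (t := (n * (28 * l + 54) + 8) + ((n * 32 + 10) + (((2 * L + 1) * 10 + 28) +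
    (((2 * L + 2 * n + 5) * (n * n * 48 + n * 86 + 46) + 4) +
      (((2 * n + 6) * 32 + 40) + (28 * (n + l + 2) + 50)))))) (R := _) ?_ ?_ fun _ _ h => h
  swap
  · have h1 : n ≤ n ^ 2 := Nat.le_self_pow (by norm_num) n
    have h2 : n * L ≤ n ^ 2 * L := Nat.mul_le_mul_right _ h1
    have h3 : L ≤ n ^ 2 * L := Nat.le_mul_of_pos_left _ (by positivity)
    have h4 : n * l ≤ n * L := Nat.mul_le_mul_left _ (by omega)
    have h5 : (2 * L + 2 * n + 5) * (n * n * 48 + n * 86 + 46)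
        ≤ (7 * L) * (180 * n ^ 2) := by
      refine Nat.mul_le_mul (by omega) ?_
      rw [← sq]
      omega
    have h6 : (7 * L) * (180 * n ^ 2) = 1260 * (n ^ 2 * L) := by ring
    have h7 : 2500 * n ^ 2 * L = 2500 * (n ^ 2 * L) := by ring
    have h8 : n * (28 * l + 54) = 28 * (n * l) + 54 * n := by ring
    rw [h7, h8]
    omega
  refine Runs.seq (runs_lcmLoop hb (small_inputState (by omega) (hpow _ (by omega)))
    (hasInput_inputState M c) hnN (commonDen_lt c) (hpow _ (by omega))) ?_
  rintro s₁ hs₁ ⟨hin₁, h3₁⟩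
  refine Runs.seq (runs_scaleLoop hb hs₁ hin₁ h3₁ hnN hstart
    (hSL.trans_lt (hpow' _ (by omega))) (hpow' _ (by omega))) ?_
  rintro s₂ hs₂ ⟨hin₂, hm1, hm, hm2, h8₂⟩
  obtain ⟨W, T, hT, hT2, hW, hr, hunst⟩ := exists_ratSystem_growthRate (M := M) hm
  refine Runs.seq (runs_bracket hb hs₂ h8₂ (hm2.trans hSL) (hpow' _ (by omega))).frame ?_
  rintro s₃ hs₃ ⟨⟨h9, j, hj, h10, h11, hmj⟩, hv, ha⟩
  have hin₃ : HasScaled M c s₃ := hin₂.of_eq (hv 0 (by decide)) (hv 3 (by decide))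
    fun a _ => ha a (by simp [bracket, arrs])
  have h8₃ : s₃.var 8 = 2 ^ n := (hv 8 (by decide)).trans h8₂
  have hBpos : (0 : ℤ) < 2 ^ (2 * n + 4) := by positivity
  have hTz : (0 : ℤ) < T := by exact_mod_cast hT
  have h2j : (2 : ℤ) ^ (j + 1) = 2 ^ j + 2 ^ j := by ring
  have hWabs := abs_le.mp hW
  have hmT : s₂.var 7 * 2 ^ (2 * n + 4) * T ≤ 2 ^ j * T := mul_le_mul_of_nonneg_right hmj hTz.le
  have hBT : (0 : ℤ) < 2 ^ (2 * n + 4) * T := by positivity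
  have hWl := mul_le_mul_of_nonneg_left hWabs.1 hBpos.le
  have hWu := mul_le_mul_of_nonneg_left hWabs.2 hBpos.le
  have hjS : (2 : ℤ) ^ j ≤ 2 ^ (2 * L + 2 * n + 4) := pow_le_pow_right₀ (by norm_num) hj
  refine Runs.seq ((runs_search (S := 2 ^ j) (J := j + 1)
    (D := 2 ^ (2 * n + 4) * 2 ^ l + 2 ^ (2 * L + 2 * n + 4)) hb hs₃ hn hin₃ h9 ?_ ?_ hnn'
    (hpow' _ (by omega)) h10 ?_ ?_ (by rw [h11]) (by rw [h11]; linarith)).frame.mono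
      (Nat.add_le_add_right (Nat.mul_le_mul_right _ (by omega)) _) fun _ _ h => h) ?_
  · intro a ha v
    refine (abs_sub _ _).trans (add_le_add ?_ (ha.trans hjS))
    rw [abs_mul, abs_of_pos hBpos]
    exact mul_le_mul_of_nonneg_left (hstart v) hBpos.le
  · have h1 : (2 : ℤ) ^ (2 * n + 4) * 2 ^ l ≤ 2 ^ (2 * L + 2 * n + 4) := by
      rw [← pow_add]
      exact pow_le_pow_right₀ (by norm_num) (by omega)
    have h2 : (n : ℤ) * (2 ^ (n + 2) * (2 ^ (2 * n + 4) * 2 ^ l + 2 ^ (2 * L + 2 * n + 4)))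
        ≤ 2 ^ n * (2 ^ (n + 2) * (2 ^ (2 * L + 2 * n + 4) + 2 ^ (2 * L + 2 * n + 4))) := by
      gcongr
      linarith
    have h3 : (2 : ℤ) ^ n * (2 ^ (n + 2) * (2 ^ (2 * L + 2 * n + 4) + 2 ^ (2 * L + 2 * n + 4)))
        = 2 ^ (2 * L + 4 * n + 7) := by ring
    rw [h3] at h2
    exact h2.trans_lt (hpow' _ (by omega))
  · rw [h11, hunst _ _ hBpos]
    linarith
  · rw [h11, hunst _ _ hBpos, h2j]
    linarith
  rintro s₄ hs₄ ⟨⟨hin₄, h9₄, hlo, hu, hu'⟩, hv₄, -⟩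
  rw [hunst _ _ hBpos] at hu hu'
  exact runs_approx_reduce hb hs₄ hin₄.commonDen ((hv₄ 8 (by decide)).trans h8₃) h9₄ rfl
    (commonDen_lt c) hlo (hpow _ (by omega)) (hpow _ (by omega)) (hpow _ (by omega)) hT hT2 hr hu
    (not_lt.mp hu')

theorem computesGrowthRate_growthRateProgram [NeZero n] {w t : ℕ} (hw : 256 * (n + bitLength c) ≤ w)
    (ht : 2500 * n ^ 2 * (n + bitLength c) ≤ t) :
    ComputesGrowthRate growthRateProgram M c w t := by
  obtain ⟨s, k, h1, h2, -, r, h3, h4⟩ := runs_growthRateProgram (M := M) hw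
  exact ⟨r, h3, s, k, h1, h2.trans ht, h4⟩

end

/-- Denominators up to H divide H!, and so does their least common multiple. -/
theorem bitLength_le {n : ℕ} {c : Fin n → ℚ} {H : ℕ}
    (hc : ∀ v, (c v).num.natAbs ≤ H ∧ (c v).den ≤ H) :
    bitLength c ≤ Nat.size H.factorial + Nat.size (H * H.factorial) := by
  have hd : commonDen c ≤ H.factorial := Nat.le_of_dvd H.factorial_pos
    (Finset.lcm_dvd fun v _ => Nat.dvd_factorial (c v).den_pos (hc v).2)
  refine Nat.add_le_add (Nat.size_le_size hd) (Nat.size_le_size (Finset.sup_le fun v _ => ?_))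
  rw [commonDen_mul, Rat.num_intCast, scaledStart, Int.natAbs_mul, Int.natAbs_natCast]
  exact Nat.mul_le_mul (hc v).1 ((Nat.div_le_self _ _).trans hd)

end RAM

theorem theorem6 :
    ∃ P : RAM.Program,
      (∃ C : ℕ, ∀ (n : ℕ) [NeZero n] (M : Fin n → Fin n × Fin n) (c : Fin n → ℚ),
        ComputesGrowthRate P M c (C * (n + bitLength c)) (C * n ^ 2 * (n + bitLength c))) ∧
      (∀ H : ℕ, ∃ C : ℕ, ∀ (n : ℕ) [NeZero n] (M : Fin n → Fin n × Fin n) (c : Fin n → ℚ),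
        (∀ v, (c v).num.natAbs ≤ H ∧ (c v).den ≤ H) →
          ComputesGrowthRate P M c (C * n) (C * n ^ 3)) := by
  refine ⟨RAM.growthRateProgram, ⟨2500, fun n _ M c => ?_⟩, fun H => ?_⟩
  · exact RAM.computesGrowthRate_growthRateProgram (Nat.mul_le_mul_right _ (by norm_num)) le_rfl
  · set K := Nat.size H.factorial + Nat.size (H * H.factorial)
    refine ⟨2500 * (1 + K), fun n _ M c hc => ?_⟩
    have hn : 1 ≤ n := Nat.pos_of_ne_zero (NeZero.ne n)
    -- `K` depends on `H` only, and n ≥ 1 absorbs it into a multiple of n.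
    have hl : n + bitLength c ≤ (1 + K) * n := by
      have h1 : bitLength c ≤ K * n := (RAM.bitLength_le hc).trans (Nat.le_mul_of_pos_right _ hn)
      linarith
    refine RAM.computesGrowthRate_growthRateProgram ?_ ?_
    · rw [mul_assoc]
      exact Nat.mul_le_mul (by norm_num) hl
    · calc 2500 * n ^ 2 * (n + bitLength c) ≤ 2500 * n ^ 2 * ((1 + K) * n) :=
            Nat.mul_le_mul_left _ hl
        _ = 2500 * (1 + K) * n ^ 3 := by ring
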